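/- Let $\mathfrak{u}_0$ be a compact semisimple real Lie algebra (finite dimensional, with negative definite Killing form), $\mathfrak{t}_0$ a maximal abelian subalgebra, $\mathfrak{g}=\mathbb{C}\otimes\mathfrak{u}_0$, $\mathfrak{h}=\mathbb{C}\otimes\mathfrak{t}_0$, with $Z\mapsto\bar Z$ the conjugation of $\mathfrak{g}$ with respect to $\mathfrak{u}_0$. Let $\mathcal{R}\subset\mathfrak{h}^*\setminus\{0\}$ be the root system of $(\mathfrak{g},\mathfrak{h})$ and $\mathfrak{g}^\alpha$ the root spaces. Thus $\mathfrak{u}_0$, $\mathfrak{t}_0$ are the Lie algebras of a compact semisimple group $\mathbf{U}_0$ and of a maximal torus $\mathbf{T}_0$, and $M=\mathbf{U}_0/\mathbf{T}_0$ is a complete flag. Let $\mathfrak{Q}(\mathcal{R})$ be the set of all $\mathcal{Q}\subset\mathcal{R}$ such that (a) $\alpha\in\mathcal{Q}\Rightarrow-\alpha\notin\mathcal{Q}$; (b) $\alpha,\beta\in\mathcal{Q}\Rightarrow\alpha+\beta\notin\mathcal{R}$; (c) $\mathcal{R}\subset\mathbb{Z}[\mathcal{Q}]$, i.e. every root is an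 integral linear combination of elements of $\mathcal{Q}$. Let $\mathcal{Q}\in\mathfrak{Q}(\mathcal{R})$ and endow $M$ with the $\mathbf{U}_0$-homogeneous $CR$ structure defined by the $CR$ algebra $(\mathfrak{u}_0,\mathfrak{q})$, where $\mathfrak{q}=\mathfrak{h}\oplus\sum_{\alpha\in\mathcal{Q}}\mathfrak{g}^\alpha$ is a complex Lie subalgebra of $\mathfrak{g}$ with $\mathfrak{q}\cap\bar{\mathfrak{q}}=\mathfrak{h}$. For $h\in\mathbb{Z}$ put $$\mathcal{Q}^*_{1,1}=\{\pm(\beta_1-\beta_2)\in\mathcal{R}\mid\beta_1,\beta_2\in\mathcal{Q}\},\qquad \mathcal{Q}^*_h=\Big\{\sum k_i\beta_i\in\mathcal{R}\;\Big|\;\beta_i\in\mathcal{Q},\ k_i\in\mathbb{Z},\ \sum k_i=h\Big\},$$ $$\mathfrak{g}^{(0)}=\mathfrak{h}\oplus\sum_{\alpha\in\mathcal{Q}^*_0}\mathfrak{g}^\alpha,\qquad \mathfrak{g}^{(h)}=\sum_{\alpha\in\mathcal{Q}^*_h}\mathfrak{g}^\alpha\quad(h\neq0),$$ so that $\mathfrak{g}=\sum_{h\in\mathbb{Z}}\mathfrak{g}^{(h)}$.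 Terminology, for a $CR$ algebra $(\mathfrak{g}_0,\mathfrak{q})$, i.e. a real Lie algebra $\mathfrak{g}_0$ (here finite dimensional) and a complex Lie subalgebra $\mathfrak{q}$ of its complexification $\mathfrak{g}$: let $\mathfrak{i}_0=\mathfrak{q}\cap\mathfrak{g}_0$, let $\mathfrak{V}_0=\{\mathrm{Re}\,Z\mid Z\in\mathfrak{q}\}\subset\mathfrak{g}_0$, and let $\mathfrak{q}^\natural$ be the Lie subalgebra of $\mathfrak{g}$ generated by $\mathfrak{q}+\bar{\mathfrak{q}}$. * $(\mathfrak{g}_0,\mathfrak{q})$ is *$CR$-symmetric* if $\mathfrak{i}_0$ is almost compact in $\mathfrak{g}_0$ (the direct sum of a subalgebra on which the Killing form of $\mathfrak{g}_0$ is negative definite and of a subspace of the kernel of that form) and there is a complex linear Lie algebra automorphism $\lambda$ of $\mathfrak{g}$ with $\lambda^2=\mathrm{Id}$, $\lambda(\mathfrak{g}_0)=\mathfrak{g}_0$, $\ker(\mathrm{Id}-\lambda)\subset\mathfrak{q}^\natural$, $\lambda(\mathfrak{q})=\mathfrak{q}$, and $Z+\lambda(Z)\in\mathfrak{q}\cap\bar{\mathfrak{q}}$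 for all $Z\in\mathfrak{q}$. We say that $M$ is *$\mathbf{U}_0$-$CR$-symmetric* if $(\mathfrak{u}_0,\mathfrak{q})$ is $CR$-symmetric. * $(\mathfrak{g}_0,\mathfrak{q})$ has the *$J$-property* if there is a derivation $J$ of $\mathfrak{g}_0$ with $J(\mathfrak{i}_0)\subset\mathfrak{i}_0$ and $X+iJ(X)\in\mathfrak{q}$ for all $X\in\mathfrak{V}_0$. * $(\mathfrak{g}_0,\mathfrak{q})$ has the *weak-$J$-property* if there is a derivation $J$ of $\mathfrak{g}_0$ such that $\Upsilon=\exp(\pi J/2)$ satisfies $\Upsilon(\mathfrak{i}_0)=\mathfrak{i}_0$ and $X+i\Upsilon(X)\in\mathfrak{q}$ for all $X\in\mathfrak{V}_0$. **Theorem.** 1. $M$ is $\mathbf{U}_0$-$CR$-symmetric if and only if $\mathcal{Q}^*_{1,1}\cap\mathcal{Q}^*_{2h+1}=\emptyset$ for all $h\in\mathbb{Z}$. 2. $(\mathfrak{u}_0,\mathfrak{q})$ has the weak-$J$-property if and only if $\mathcal{Q}^*_{1,1}\cap\mathcal{Q}^*_{2h+1}=\emptyset$ and $\mathcal{Q}^*_{1,1}\cap\mathcal{Q}^*_{4h+2}=\emptyset$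 for all $h\in\mathbb{Z}$. 3. $(\mathfrak{u}_0,\mathfrak{q})$ has the $J$-property if and only if $\mathfrak{g}=\sum_{h\in\mathbb{Z}}\mathfrak{g}^{(h)}$ is a $\mathbb{Z}$-gradation of $\mathfrak{g}$, i.e. the sum is direct and $[\mathfrak{g}^{(h)},\mathfrak{g}^{(k)}]\subset\mathfrak{g}^{(h+k)}$ for all $h,k\in\mathbb{Z}$. -/

import Mathlib

open scoped TensorProduct
open Real

noncomputable section

namespace CRFlag

/-! ### `CR` algebras -/

section CRAlgebras

variable {g₀ : Type*} [LieRing g₀] [LieAlgebra ℝ g₀]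

/-- Conjugation of the complexification `g = ℂ ⊗ g₀` with respect to the real form `g₀`. -/
def conj : (ℂ ⊗[ℝ] g₀) →ₗ⁅ℝ⁆ (ℂ ⊗[ℝ] g₀) :=
  LieAlgebra.ExtendScalars.map (Complex.conjAe : ℂ →ₐ[ℝ] ℂ) (LieHom.id : g₀ →ₗ⁅ℝ⁆ g₀)

/-- The element `x + i y` of `g = ℂ ⊗ g₀`, for `x, y ∈ g₀`. -/
def cplx (x y : g₀) : ℂ ⊗[ℝ] g₀ := (1 : ℂ) ⊗ₜ[ℝ] x + Complex.I ⊗ₜ[ℝ] y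

variable (q : LieSubalgebra ℂ (ℂ ⊗[ℝ] g₀))

/-- The isotropy subalgebra `i₀ = q ∩ g₀` of the `CR` algebra `(g₀, q)`. -/
def isotropy : LieSubalgebra ℝ g₀ where
  carrier := {x | (1 : ℂ) ⊗ₜ[ℝ] x ∈ q}
  add_mem' {x y} hx hy := by
    change _ ∈ q at hx hy ⊢
    rw [TensorProduct.tmul_add]
    exact q.add_mem hx hy
  zero_mem' := by
    change _ ∈ q
    rw [TensorProduct.tmul_zero]
    exact q.zero_mem
  smul_mem' c x hx := by
    change _ ∈ q at hx ⊢
    have h : (1 : ℂ) ⊗ₜ[ℝ] (c • x) = (c : ℂ) • ((1 : ℂ) ⊗ₜ[ℝ] x) := by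
      rw [TensorProduct.tmul_smul, TensorProduct.smul_tmul', TensorProduct.smul_tmul']
      simp
    rw [h]
    exact q.smul_mem _ hx
  lie_mem' {x y} hx hy := by
    change _ ∈ q at hx hy ⊢
    have h := q.lie_mem hx hy
    rwa [LieAlgebra.ExtendScalars.bracket_tmul, one_mul] at h

/-- The complex Lie subalgebra of `g` generated by `q` and its conjugate. -/
def qNatural : LieSubalgebra ℂ (ℂ ⊗[ℝ] g₀) :=
  LieSubalgebra.lieSpan ℂ (ℂ ⊗[ℝ] g₀)
    ((q : Set (ℂ ⊗[ℝ] g₀)) ∪ conj '' (q : Set (ℂ ⊗[ℝ] g₀)))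

/-- The set `V₀ = {Re Z | Z ∈ q}` of the real parts of the elements of `q`. -/
def realParts : Set g₀ := {x | ∃ y : g₀, cplx x y ∈ q}

/-- A subalgebra `k` of `g₀` is compact in `g₀` if the Killing form of `g₀` is negative definite
on `k`. -/
def IsCompactIn (k : LieSubalgebra ℝ g₀) : Prop :=
  ∀ x ∈ k, x ≠ 0 → killingForm ℝ g₀ x x < 0

/-- A subalgebra of `g₀` is almost compact in `g₀` if it is the direct sum of a subalgebra which is
compact in `g₀` and of a subspace of the kernel of the Killing form of `g₀`. -/
def IsAlmostCompactIn (i₀ : LieSubalgebra ℝ g₀) : Prop :=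
  ∃ (k : LieSubalgebra ℝ g₀) (r : Submodule ℝ g₀),
    IsCompactIn k ∧ r ≤ LinearMap.ker (killingForm ℝ g₀) ∧
      Disjoint k.toSubmodule r ∧ k.toSubmodule ⊔ r = i₀.toSubmodule

/-- The `CR` algebra `(g₀, q)` is `CR`-symmetric: the isotropy is almost compact in `g₀`, and there
is an involution `lam` of `g` with `lam g₀ = g₀`, `ker (Id - lam) ⊆ q♮`, `lam q = q`, and
`Z + lam Z ∈ q ∩ conj q` for all `Z ∈ q`. -/
def IsCRSymmetric : Prop :=
  IsAlmostCompactIn (isotropy q) ∧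
    ∃ lam : (ℂ ⊗[ℝ] g₀) →ₗ⁅ℂ⁆ (ℂ ⊗[ℝ] g₀),
      (∀ z, lam (lam z) = z) ∧
      lam '' (Set.range fun x : g₀ => (1 : ℂ) ⊗ₜ[ℝ] x) =
        (Set.range fun x : g₀ => (1 : ℂ) ⊗ₜ[ℝ] x) ∧
      (∀ z, lam z = z → z ∈ qNatural q) ∧
      lam '' (q : Set (ℂ ⊗[ℝ] g₀)) = (q : Set (ℂ ⊗[ℝ] g₀)) ∧
      ∀ z ∈ q, z + lam z ∈ q ∧ conj (z + lam z) ∈ q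

/-- The `J`-property of the `CR` algebra `(g₀, q)`. -/
def HasJProperty : Prop :=
  ∃ J : LieDerivation ℝ g₀ g₀,
    (∀ x ∈ isotropy q, J x ∈ isotropy q) ∧ ∀ x ∈ realParts q, cplx x (J x) ∈ q

/-- The exponential of an endomorphism of a finite dimensional real vector space, computed on
its matrix in a basis; the result does not depend on the basis. -/
def endExp {V : Type*} [AddCommGroup V] [Module ℝ V] [FiniteDimensional ℝ V]
    (A : V →ₗ[ℝ] V) : V →ₗ[ℝ] V :=
  Matrix.toLin (Module.finBasis ℝ V) (Module.finBasis ℝ V)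
    (NormedSpace.exp (LinearMap.toMatrix (Module.finBasis ℝ V) (Module.finBasis ℝ V) A))

/-- The weak-`J`-property of the `CR` algebra `(g₀, q)`: with `Υ = exp (π J / 2)` for a derivation
`J` of `g₀`, one has `Υ i₀ = i₀` and `X + i Υ X ∈ q` for all `X ∈ V₀`. -/
def HasWeakJProperty [FiniteDimensional ℝ g₀] : Prop :=
  ∃ J : LieDerivation ℝ g₀ g₀,
    endExp ((π / 2) • J.toLinearMap) '' (isotropy q : Set g₀) = (isotropy q : Set g₀) ∧
      ∀ x ∈ realParts q, cplx x (endExp ((π / 2) • J.toLinearMap) x) ∈ q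

end CRAlgebras

/-! ### Roots -/

section Roots

variable {u₀ : Type*} [LieRing u₀] [LieAlgebra ℝ u₀]

/-- The bracket of two linear spans lies in a subspace when the brackets of generators do. -/
theorem lie_mem_of_mem_span {L : Type*} [LieRing L] [LieAlgebra ℂ L] {S : Set L}
    {p : Submodule ℂ L} (h : ∀ a ∈ S, ∀ b ∈ S, ⁅a, b⁆ ∈ p) {x y : L}
    (hx : x ∈ Submodule.span ℂ S) (hy : y ∈ Submodule.span ℂ S) : ⁅x, y⁆ ∈ p := by
  refine Submodule.span_induction₂ (p := fun x y _ _ => ⁅x, y⁆ ∈ p)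
    (fun a b ha hb => h a ha b hb) (by simp) (by simp) ?_ ?_ ?_ ?_ hx hy
  · intro _ _ _ _ _ _ h₁ h₂
    rw [add_lie]
    exact add_mem h₁ h₂
  · intro _ _ _ _ _ _ h₁ h₂
    rw [lie_add]
    exact add_mem h₁ h₂
  · intro _ _ _ _ _ h₁
    rw [smul_lie]
    exact p.smul_mem _ h₁
  · intro _ _ _ _ _ h₁
    rw [lie_smul]
    exact p.smul_mem _ h₁

/-- The complexification `ℂ ⊗ t₀ ⊆ ℂ ⊗ u₀` of a subalgebra `t₀` of `u₀`. -/
def complexify (t₀ : LieSubalgebra ℝ u₀) : LieSubalgebra ℂ (ℂ ⊗[ℝ] u₀) where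
  toSubmodule := t₀.toSubmodule.baseChange ℂ
  lie_mem' {x y} hx hy := by
    simp only [AddSubsemigroup.mem_carrier, AddSubmonoid.mem_toSubsemigroup,
      Submodule.mem_toAddSubmonoid] at hx hy ⊢
    rw [Submodule.baseChange_eq_span] at hx hy
    refine lie_mem_of_mem_span ?_ hx hy
    rintro _ ⟨a, ha, rfl⟩ _ ⟨b, hb, rfl⟩
    simp only [TensorProduct.mk_apply, LieAlgebra.ExtendScalars.bracket_tmul]
    exact Submodule.tmul_mem_baseChange_of_mem _ (t₀.lie_mem ha hb)

variable (t₀ : LieSubalgebra ℝ u₀)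

instance complexify_isLieAbelian [IsLieAbelian t₀] : IsLieAbelian (complexify t₀) := by
  refine ⟨fun x y => Subtype.ext ?_⟩
  obtain ⟨x, hx⟩ := x
  obtain ⟨y, hy⟩ := y
  change ⁅x, y⁆ = 0
  rw [← Submodule.mem_bot ℂ]
  change x ∈ t₀.toSubmodule.baseChange ℂ at hx
  change y ∈ t₀.toSubmodule.baseChange ℂ at hy
  rw [Submodule.baseChange_eq_span] at hx hy
  refine lie_mem_of_mem_span ?_ hx hy
  rintro _ ⟨a, ha, rfl⟩ _ ⟨b, hb, rfl⟩
  have h : (⁅(⟨a, ha⟩ : t₀), (⟨b, hb⟩ : t₀)⁆ : t₀) = 0 := trivial_lie_zero _ _ _ _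
  have h' : ⁅a, b⁆ = 0 := congrArg Subtype.val h
  simp [h']

variable [IsLieAbelian t₀]

/-- The set of roots `R ⊆ h*` of `h = ℂ ⊗ t₀` in `g = ℂ ⊗ u₀`. -/
def roots : Set (Module.Dual ℂ (complexify t₀)) :=
  {α | α ≠ 0 ∧ LieAlgebra.rootSpace (complexify t₀) α ≠ ⊥}

/-- The condition `Q ∈ 𝔔(R)`. -/
structure IsFlagSet (Q : Set (Module.Dual ℂ (complexify t₀))) : Prop where
  subset_roots : Q ⊆ roots t₀
  neg_notMem : ∀ α ∈ Q, -α ∉ Q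
  add_notMem : ∀ α ∈ Q, ∀ β ∈ Q, α + β ∉ roots t₀
  roots_subset : roots t₀ ⊆ AddSubgroup.closure Q

variable (Q : Set (Module.Dual ℂ (complexify t₀)))

/-- The subspace `h ⊕ ∑_{α ∈ Q} g^α` of `g`. -/
def flagSubspace : Submodule ℂ (ℂ ⊗[ℝ] u₀) :=
  (complexify t₀).toSubmodule ⊔
    ⨆ α ∈ Q, (LieAlgebra.rootSpace (complexify t₀) α).toSubmodule

/-- The root combinations `Q*_{1,1} = {±(β₁ - β₂) ∈ R | β₁, β₂ ∈ Q}`. -/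
def qStarOneOne : Set (Module.Dual ℂ (complexify t₀)) :=
  {γ | γ ∈ roots t₀ ∧ ∃ β₁ ∈ Q, ∃ β₂ ∈ Q, γ = β₁ - β₂ ∨ γ = -(β₁ - β₂)}

/-- The root combinations `Q*_h = {∑ kᵢ βᵢ ∈ R | βᵢ ∈ Q, kᵢ ∈ ℤ, ∑ kᵢ = h}`. -/
def qStar (h : ℤ) : Set (Module.Dual ℂ (complexify t₀)) :=
  {γ | γ ∈ roots t₀ ∧ ∃ k : Q →₀ ℤ,
    γ = k.sum (fun β n => n • (β : Module.Dual ℂ (complexify t₀))) ∧ h = k.sum fun _ n => n}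

/-- The subspaces `∑_{α ∈ Q*_h} g^α` for `h ≠ 0` and `h ⊕ ∑_{α ∈ Q*_0} g^α` for `h = 0`. -/
def gradedPiece (h : ℤ) : Submodule ℂ (ℂ ⊗[ℝ] u₀) :=
  (if h = 0 then (complexify t₀).toSubmodule else ⊥) ⊔
    ⨆ α ∈ qStar t₀ Q h, (LieAlgebra.rootSpace (complexify t₀) α).toSubmodule

/-- A family of subspaces `V h`, for `h ∈ ℤ`, is a `ℤ`-gradation of the Lie algebra `g`. -/
def IsZGradation {g : Type*} [LieRing g] [LieAlgebra ℂ g] (V : ℤ → Submodule ℂ g) : Prop :=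
  DirectSum.IsInternal V ∧ ∀ h k : ℤ, ∀ x ∈ V h, ∀ y ∈ V k, ⁅x, y⁆ ∈ V (h + k)

variable {Q}

theorem rootSpace_lie_mem (α β : Module.Dual ℂ (complexify t₀)) {x y : ℂ ⊗[ℝ] u₀}
    (hx : x ∈ LieAlgebra.rootSpace (complexify t₀) α)
    (hy : y ∈ LieAlgebra.rootSpace (complexify t₀) β) :
    ⁅x, y⁆ ∈ LieAlgebra.rootSpace (complexify t₀) (α + β : Module.Dual ℂ (complexify t₀)) :=
  LieAlgebra.lie_mem_genWeightSpace_of_mem_genWeightSpace hx hy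

theorem flagSubspace_lie_mem (hQ : IsFlagSet t₀ Q) {x y : ℂ ⊗[ℝ] u₀}
    (hx : x ∈ flagSubspace t₀ Q) (hy : y ∈ flagSubspace t₀ Q) : ⁅x, y⁆ ∈ flagSubspace t₀ Q := by
  have hroot : ∀ (α : Module.Dual ℂ (complexify t₀)), α ∈ Q →
      ∀ z ∈ LieAlgebra.rootSpace (complexify t₀) α, z ∈ flagSubspace t₀ Q := fun α hα z hz =>
    (le_sup_right : _ ≤ flagSubspace t₀ Q)
      (Submodule.mem_iSup_of_mem α (Submodule.mem_iSup_of_mem hα hz))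
  have hcart : ∀ z ∈ complexify t₀, z ∈ flagSubspace t₀ Q := fun z hz =>
    (le_sup_left : _ ≤ flagSubspace t₀ Q) hz
  have hspan : flagSubspace t₀ Q = Submodule.span ℂ ({z | z ∈ complexify t₀} ∪
      {z | ∃ α ∈ Q, z ∈ LieAlgebra.rootSpace (complexify t₀) α}) := by
    apply le_antisymm
    · refine sup_le (fun z hz => Submodule.subset_span (Or.inl hz)) ?_
      exact iSup₂_le fun α hα z hz => Submodule.subset_span (Or.inr ⟨α, hα, hz⟩)
    · refine Submodule.span_le.mpr ?_
      rintro z (hz | ⟨α, hα, hz⟩)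
      · exact hcart z hz
      · exact hroot α hα z hz
  have hx' := hx
  have hy' := hy
  rw [hspan] at hx' hy'
  refine lie_mem_of_mem_span ?_ hx' hy'
  · rintro a (ha | ⟨α, hα, ha⟩) b (hb | ⟨β, hβ, hb⟩)
    · exact hcart _ ((complexify t₀).lie_mem ha hb)
    · exact hroot β hβ _
        ((LieAlgebra.rootSpace (complexify t₀) β).lie_mem (x := (⟨a, ha⟩ : complexify t₀)) hb)
    · rw [← lie_skew]
      exact neg_mem (hroot α hα _
        ((LieAlgebra.rootSpace (complexify t₀) α).lie_mem (x := (⟨b, hb⟩ : complexify t₀)) ha))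
    · have hab := rootSpace_lie_mem t₀ α β ha hb
      by_cases h0 : α + β = 0
      · exact absurd (by rwa [← eq_neg_of_add_eq_zero_right h0]) (hQ.neg_notMem α hα)
      · have hbot : LieAlgebra.rootSpace (complexify t₀)
            (α + β : Module.Dual ℂ (complexify t₀)) = ⊥ := by
          by_contra hne
          exact hQ.add_notMem α hα β hβ ⟨h0, hne⟩
        rw [hbot, LieSubmodule.mem_bot] at hab
        rw [hab]
        exact zero_mem _

/-- The complex Lie subalgebra `q = h ⊕ ∑_{α ∈ Q} g^α` of `g`, for `Q ∈ 𝔔(R)`. -/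
def flagSubalgebra (hQ : IsFlagSet t₀ Q) : LieSubalgebra ℂ (ℂ ⊗[ℝ] u₀) where
  toSubmodule := flagSubspace t₀ Q
  lie_mem' hx hy := flagSubspace_lie_mem t₀ hQ hx hy

end Roots

end CRFlag

end

/-!
The argument rests on one fact about the root system: a root that is an integral combination of
elements of `Q` can be reached from `0` by adding or subtracting elements of `Q` one at a time
without leaving the set of weights (`weight_induction`). If `α = ∑ βᵢ` is a root with `βᵢ ∈ Q ∪ -Q`,
then `2 = ∑ βᵢ(α^∨)`, so that some `βᵢ(α^∨)` is positive and `α - βᵢ` is a weight. Since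
`[𝔤^α, 𝔤^β] ≠ 0` whenever `α`, `β` and `α + β` are weights with `α ≠ 0` (`exists_lie_ne_zero`), it
follows that `𝔥` and the root spaces of `±Q` generate `𝔤`, hence `q♮ = 𝔤`, and that an automorphism
preserving `𝔥` and acting as a scalar `c` on `q / 𝔥` is the identity on `𝔥` and acts as `c ^ h` on
`𝔤^α` for every `α ∈ Q*_h` (`lieHom_apply_of_mem_rootSpace`). As `Q*_{1,1} ⊆ Q*_0`, this forces
`c ^ h = 1` if `Q*_{1,1}` meets `Q*_h`. A `CR`-symmetry is such an automorphism with `c = -1`, the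
automorphism `Υ` of the weak-`J`-property is one with `c = -i` (the exponential of a derivation is
an automorphism, `endExp_lie`). In the case of the `J`-property the derivation is `ad W` with
`W ∈ 𝔱₀` and `β(W) = -i` on `Q`, and the `𝔤^{(h)}` are the eigenspaces of `ad W`.

Conversely, let `m` be `2`, `4` or `0` in the three cases. The combinatorial condition implies that
`m` divides `∑ kᵢ` for every relation `∑ kᵢ βᵢ = 0`: adding the relation to an element of `Q*_{1,1}`
shifts its height by `∑ kᵢ`, and if `Q*_{1,1}` is empty, then `Q` is strongly orthogonal and has no
nontrivial relations (`dvd_height_of_inter_eq_empty`); for the `ℤ`-gradation it shifts the degree of an element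
of `Q`. So the height modulo `m` is well defined on the root lattice, and because the lattice is
free, the negated height lifts to an additive integer valued function `n` with `n(β) ≡ -1` modulo
`m` on `Q` (`exists_additive_of_dvd_height`). The endomorphisms acting on `𝔤^α` as `(-1) ^ n(α)` and
as `i n(α)` are then an automorphism and a derivation with the required properties; they are defined
over `ℝ` because the conjugation exchanges `𝔤^α` and `𝔤^{-α}` (`conj_mem_rootSpace`).
-/

set_option linter.unusedSectionVars false

namespace CRFlag

/-! ### Root spaces and strings of weights -/

section RootSpaces

open LieAlgebra LieModule LieAlgebra.IsKilling

variable {K L : Type*} [Field K] [CharZero K] [LieRing L] [LieAlgebra K L]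
  [IsKilling K L] [FiniteDimensional K L]
  {H : LieSubalgebra K L} [H.IsCartanSubalgebra] [IsTriangularizable K H L]

theorem exists_smul_eq_of_mem_rootSpace {α : Module.Dual K H} (hα : α ≠ 0) {x y : L}
    (hx : x ∈ rootSpace H α) (hx0 : x ≠ 0) (hy : y ∈ rootSpace H α) : ∃ c : K, y = c • x := by
  have hne : rootSpace H α ≠ ⊥ := fun h => hx0 (by rwa [h, LieSubmodule.mem_bot] at hx)
  let a : Weight K H L := ⟨α, hne⟩
  have ha : a.IsNonZero := fun h => hα (by ext z; exact congrFun h z)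
  obtain ⟨c, hc⟩ := (finrank_eq_one_iff_of_nonzero' (⟨x, hx⟩ : rootSpace H α)
    (by simpa using hx0)).mp (finrank_rootSpace_eq_one a ha) ⟨y, hy⟩
  exact ⟨c, (congrArg Subtype.val hc).symm⟩

/-- In an `α`-string of weights of an `sl₂`-module the raising operator is nonzero on every weight
space below the top one. Here `β` may be `0` or `-α`. -/
theorem exists_lie_ne_zero {α β : Module.Dual K H} (hα : α ≠ 0) (hαr : rootSpace H α ≠ ⊥)
    (hβ : rootSpace H β ≠ ⊥) (hαβ : rootSpace H (α + β : Module.Dual K H) ≠ ⊥) :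
    ∃ x ∈ rootSpace H α, ∃ y ∈ rootSpace H β, ⁅x, y⁆ ≠ 0 := by
  let a : Weight K H L := ⟨α, hαr⟩
  let b : Weight K H L := ⟨β, hβ⟩
  have ha : a.IsNonZero := fun h => hα (by ext z; exact congrFun h z)
  have h1 : 1 ≤ chainTopCoeff a b := by
    have := (rootSpace_zsmul_add_ne_bot_iff a b ha 1).mp (by rw [one_smul]; exact hαβ)
    exact_mod_cast this.1
  obtain ⟨n, hn⟩ : ∃ n, chainTopCoeff a b = n + 1 := ⟨_, (Nat.sub_add_cancel h1).symm⟩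
  have hlen : n + 1 ≤ chainLength a b := hn ▸ chainTopCoeff_le_chainLength a b
  obtain ⟨x, hx, x_ne0⟩ := (chainTop a b).exists_ne_zero
  obtain ⟨h, e, f, isSl2, he, hf⟩ := exists_isSl2Triple_of_weight_isNonZero ha
  obtain rfl := isSl2.h_eq_coroot ha he hf
  have prim : isSl2.HasPrimitiveVectorWith x (chainLength a b : K) :=
    have := lie_mem_genWeightSpace_of_mem_genWeightSpace he hx
    ⟨x_ne0, (chainLength_smul _ _ hx).symm, by rwa [genWeightSpace_add_chainTop _ _ ha] at this⟩
  refine ⟨e, he, (toEnd K L L f ^ (n + 1)) x, ?_, ?_⟩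
  rotate_left
  · have := prim.lie_e_pow_succ_toEnd_f n
    rw [this]
    refine smul_ne_zero (mul_ne_zero (by exact_mod_cast n.succ_ne_zero) ?_)
      (prim.pow_toEnd_f_ne_zero_of_eq_nat rfl (by omega))
    rw [sub_ne_zero]
    exact_mod_cast (by omega : chainLength a b ≠ n)
  · have := toEnd_pow_apply_mem hf hx (n + 1)
    convert! this using 2
    have hc : (chainTop a b : H → K) = (chainTopCoeff a b) • (a : H → K) + b := coe_chainTop' _ _
    rw [hc, hn, smul_neg, neg_add_cancel_left]
    rfl

/-- The coroot of a root `α`: if it is positive on a weight `β`, then `β - α` is a weight,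
and if it does not vanish on `β`, then `β - α` or `β + α` is a weight. -/
theorem exists_coroot {α : Module.Dual K H} (hα : α ≠ 0) (hαr : rootSpace H α ≠ ⊥) :
    ∃ c : H, α c = 2 ∧ ∀ β : Module.Dual K H, rootSpace H β ≠ ⊥ → ∃ m : ℤ, β c = m ∧
      (0 < m → rootSpace H (β - α : Module.Dual K H) ≠ ⊥) ∧
      (m ≠ 0 → rootSpace H (β - α : Module.Dual K H) ≠ ⊥ ∨
        rootSpace H (β + α : Module.Dual K H) ≠ ⊥) := by
  let a : Weight K H L := ⟨α, hαr⟩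
  have ha : a.IsNonZero := fun h => hα (by ext z; exact congrFun h z)
  refine ⟨coroot a, root_apply_coroot ha, fun β hβ => ?_⟩
  let b : Weight K H L := ⟨β, hβ⟩
  have hsub : 1 ≤ chainBotCoeff a b → rootSpace H (β - α : Module.Dual K H) ≠ ⊥ := by
    intro h
    have := (rootSpace_zsmul_add_ne_bot_iff a b ha (-1)).mpr ⟨by omega, by simpa using h⟩
    rwa [show ((-1 : ℤ) • (a : H → K) + b) = (β - α : Module.Dual K H) by
      ext z; simp [a, b, sub_eq_neg_add]] at this
  have hadd : 1 ≤ chainTopCoeff a b → rootSpace H (β + α : Module.Dual K H) ≠ ⊥ := by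
    intro h
    have := (rootSpace_zsmul_add_ne_bot_iff a b ha 1).mpr ⟨by exact_mod_cast h, by omega⟩
    rwa [show ((1 : ℤ) • (a : H → K) + b) = (β + α : Module.Dual K H) by
      ext z; simp [a, b, add_comm]] at this
  refine ⟨chainBotCoeff a b - chainTopCoeff a b, apply_coroot_eq_cast a b, fun h => hsub (by omega),
    fun h => ?_⟩
  by_cases h' : 1 ≤ chainBotCoeff a b
  · exact Or.inl (hsub h')
  · exact Or.inr (hadd (by omega))

theorem rootSpace_neg_ne_bot {α : Module.Dual K H} (hαr : rootSpace H α ≠ ⊥) :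
    rootSpace H (-α : Module.Dual K H) ≠ ⊥ :=
  (-(⟨α, hαr⟩ : Weight K H L)).genWeightSpace_ne_bot

theorem mem_rootSpace_zero {x : L} : x ∈ rootSpace H (0 : Module.Dual K H) ↔ x ∈ H := by
  have : rootSpace H (0 : Module.Dual K H) = H.toLieSubmodule := rootSpace_zero_eq K L H
  rw [this, LieSubalgebra.mem_toLieSubmodule]

theorem rootSpace_zero_ne_bot {α : Module.Dual K H} (hα : α ≠ 0) :
    rootSpace H (0 : Module.Dual K H) ≠ ⊥ := by
  intro h
  apply hα
  ext z
  have : (z : L) ∈ rootSpace H (0 : Module.Dual K H) := mem_rootSpace_zero.mpr z.2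
  rw [h, LieSubmodule.mem_bot] at this
  rw [show z = 0 from Subtype.ext this]
  simp

theorem submodule_eq_top_of_rootSpace_le {N : Submodule K L} (h0 : H.toSubmodule ≤ N)
    (h : ∀ α : Module.Dual K H, α ≠ 0 → rootSpace H α ≠ ⊥ → (rootSpace H α).toSubmodule ≤ N) :
    N = ⊤ := by
  have htop := LieSubmodule.iSup_toSubmodule_eq_top.mpr (iSup_genWeightSpace_eq_top' K H L)
  rw [eq_top_iff, ← htop]
  refine iSup_le fun χ => ?_
  by_cases hχ : χ.toLinear = 0
  · intro x hx
    have hx' : x ∈ rootSpace H (χ.toLinear : Module.Dual K H) := hx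
    rw [hχ] at hx'
    exact h0 (mem_rootSpace_zero.mp hx')
  · exact h χ.toLinear hχ χ.genWeightSpace_ne_bot

theorem linearMap_ext_rootSpace {M : Type*} [AddCommGroup M] [Module K M] {S T : L →ₗ[K] M}
    (h : ∀ α : Module.Dual K H, ∀ x ∈ rootSpace H α, S x = T x) : S = T := by
  have : LinearMap.eqLocus S T = ⊤ := submodule_eq_top_of_rootSpace_le (H := H)
    (fun x hx => h 0 x (mem_rootSpace_zero.mpr hx)) (fun α _ _ x hx => h α x hx)
  ext x
  exact this.ge (Submodule.mem_top (x := x))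

/-- There is an endomorphism acting on each root space by a prescribed scalar. -/
theorem exists_diagonal (f : Module.Dual K H → K) :
    ∃ T : L →ₗ[K] L, ∀ α : Module.Dual K H, ∀ x ∈ rootSpace H α, T x = f α • x := by
  classical
  have hds := DirectSum.isInternal_submodule_of_iSupIndep_of_iSup_eq_top
    (LieSubmodule.iSupIndep_toSubmodule.mpr <| iSupIndep_genWeightSpace' K H L)
    (LieSubmodule.iSup_toSubmodule_eq_top.mpr <| iSup_genWeightSpace_eq_top' K H L)
  let e := LinearEquiv.ofBijective (DirectSum.coeLinearMap fun χ : Weight K H L =>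
    (genWeightSpace L χ).toSubmodule) hds
  let T' : (DirectSum (Weight K H L) fun χ => (genWeightSpace L χ).toSubmodule) →ₗ[K] L :=
    DirectSum.toModule K _ L fun χ => f χ.toLinear • (genWeightSpace L χ).toSubmodule.subtype
  refine ⟨T' ∘ₗ e.symm.toLinearMap, fun α x hx => ?_⟩
  by_cases hα : rootSpace H α = ⊥
  · rw [hα, LieSubmodule.mem_bot] at hx
    simp [hx]
  · let χ : Weight K H L := ⟨α, hα⟩
    have hχ : χ.toLinear = α := by ext; rfl
    have hx2 : x ∈ (genWeightSpace L χ).toSubmodule := hx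
    have hx' : e (DirectSum.lof K _ (fun χ : Weight K H L => (genWeightSpace L χ).toSubmodule) χ
        ⟨x, hx2⟩) = x :=
      DirectSum.coeLinearMap_lof (A := fun χ : Weight K H L => (genWeightSpace L χ).toSubmodule) χ
        ⟨x, hx2⟩
    have hes : e.symm x = DirectSum.lof K _ (fun χ : Weight K H L =>
        (genWeightSpace L χ).toSubmodule) χ ⟨x, hx2⟩ := by rw [LinearEquiv.symm_apply_eq, hx']
    rw [LinearMap.comp_apply, LinearEquiv.coe_coe, hes, DirectSum.toModule_lof]
    simp [hχ]

/-- Induction along sums of roots. A weight that is a `ℤ`-combination of roots `p.1`, `p ∈ E`, is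
reached from `0` by adding or subtracting one of these roots at a time without leaving the set of
weights; the second component of `p` is carried along. A vanishing combination is covered as
well. -/
theorem weight_induction {E : Set (Module.Dual K H × ℤ)}
    (hE : ∀ e ∈ E, e.1 ≠ 0 ∧ rootSpace H e.1 ≠ ⊥) {P : Module.Dual K H × ℤ → Prop} (h0 : P 0)
    (step : ∀ p e, (e ∈ E ∨ -e ∈ E) → rootSpace H p.1 ≠ ⊥ → rootSpace H (p + e).1 ≠ ⊥ → P p →
      P (p + e)) {p : Module.Dual K H × ℤ} (hp : p ∈ AddSubgroup.closure E)
    (hpr : rootSpace H p.1 ≠ ⊥) : P p := by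
  have hE' : ∀ e, (e ∈ E ∨ -e ∈ E) → e.1 ≠ 0 ∧ rootSpace H e.1 ≠ ⊥ := by
    rintro e (he | he)
    · exact hE e he
    · have := hE _ he
      refine ⟨by simpa using this.1, ?_⟩
      simpa using rootSpace_neg_ne_bot this.2
  rw [← AddSubgroup.mem_toAddSubmonoid, AddSubgroup.closure_toAddSubmonoid] at hp
  obtain ⟨l, hl, rfl⟩ := AddSubmonoid.exists_list_of_mem_closure hp
  replace hl : ∀ e ∈ l, e ∈ E ∨ -e ∈ E := hl
  clear hp
  induction hn : l.length using Nat.strong_induction_on generalizing l with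
  | _ n ih =>
  subst hn
  -- Removing a summand `e` whose removal leaves a weight.
  have key : ∀ e ∈ l, rootSpace H (l.sum - e).1 ≠ ⊥ → P l.sum := by
    intro e he h
    classical
    have hperm := List.perm_cons_erase he
    have hsum : l.sum = (l.erase e).sum + e := by rw [hperm.sum_eq, List.sum_cons, add_comm]
    have h' : rootSpace H ((l.erase e).sum).1 ≠ ⊥ := by rwa [hsum, add_sub_cancel_right] at h
    rw [hsum] at hpr ⊢
    refine step _ _ (hl e he) h' hpr (ih _ ?_ (l.erase e) h'
      (fun y hy => hl y (List.mem_of_mem_erase hy)) rfl)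
    rw [hperm.length_eq, List.length_cons]
    omega
  by_cases hz : l.sum.1 = 0
  · rcases l with _ | ⟨e, t⟩
    · exact h0
    · apply key e (by simp)
      rw [Prod.fst_sub, hz, zero_sub]
      exact rootSpace_neg_ne_bot (hE' e (hl e (by simp))).2
  · obtain ⟨c, hc2, hc⟩ := exists_coroot hz hpr
    -- The coroot is positive on the whole sum, hence on some summand.
    obtain ⟨e, he, m, hm, hpos⟩ : ∃ e ∈ l, ∃ m : ℤ, e.1 c = m ∧ 0 < m := by
      by_contra! hcon
      have hle : ∀ l' : List (Module.Dual K H × ℤ), (∀ e ∈ l', e ∈ l) →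
          ∃ m : ℤ, l'.sum.1 c = m ∧ m ≤ 0 := by
        intro l'
        induction l' with
        | nil => intro _; exact ⟨0, by simp, le_rfl⟩
        | cons e t iht =>
          intro h
          obtain ⟨m, hm, hm0⟩ := iht fun e he => h e (by simp [he])
          obtain ⟨m', hm', -⟩ := hc e.1 (hE' e (hl e (h e (by simp)))).2
          exact ⟨m' + m, by simp [hm, hm'],
            by linarith [hcon e (h e (by simp)) m' hm']⟩
      obtain ⟨m, hm, hm0⟩ := hle l fun _ h => h
      rw [hc2] at hm
      have : (2 : ℤ) = m := by exact_mod_cast hm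
      omega
    apply key e he
    obtain ⟨m', hm', hsub, -⟩ := hc e.1 (hE' e (hl e he)).2
    have : m' = m := by exact_mod_cast hm'.symm.trans hm
    have := rootSpace_neg_ne_bot (hsub (this ▸ hpos))
    rwa [neg_sub] at this

end RootSpaces

/-! ### Heights and characters of the root lattice -/

section Characters

open LieAlgebra LieModule LieAlgebra.IsKilling

variable {K L : Type*} [Field K] [CharZero K] [LieRing L] [LieAlgebra K L]
  [IsKilling K L] [FiniteDimensional K L]
  {H : LieSubalgebra K L} [H.IsCartanSubalgebra] [IsTriangularizable K H L]

/-- The graph of the height function on `Q`: the subgroup it generates in `V × ℤ` consists of the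
pairs `(∑ kᵢ βᵢ, ∑ kᵢ)` with `βᵢ ∈ Q`. -/
def heightGraph {V : Type*} (Q : Set V) : Set (V × ℤ) := (fun β => (β, (1 : ℤ))) '' Q

theorem mem_closure_heightGraph {V : Type*} [AddCommGroup V] {Q : Set V} {v : V} {h : ℤ} :
    (v, h) ∈ AddSubgroup.closure (heightGraph Q) ↔
      ∃ k : Q →₀ ℤ, v = k.sum (fun β n => n • (β : V)) ∧ h = k.sum fun _ n => n := by
  constructor
  · intro hv
    suffices ∀ p ∈ AddSubgroup.closure (heightGraph Q), ∃ k : Q →₀ ℤ,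
        p.1 = k.sum (fun β n => n • (β : V)) ∧ p.2 = k.sum fun _ n => n from this _ hv
    intro p hp
    induction hp using AddSubgroup.closure_induction with
    | mem p hp =>
      obtain ⟨β, hβ, rfl⟩ := hp
      exact ⟨Finsupp.single ⟨β, hβ⟩ 1, by simp, by simp⟩
    | zero => exact ⟨0, by simp, by simp⟩
    | add p q _ _ hp hq =>
      obtain ⟨k, hk1, hk2⟩ := hp
      obtain ⟨l, hl1, hl2⟩ := hq
      refine ⟨k + l, ?_, ?_⟩
      · rw [Finsupp.sum_add_index' (by simp) (by intros; rw [add_smul]), Prod.fst_add, hk1, hl1]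
      · rw [Finsupp.sum_add_index' (by simp) (by simp), Prod.snd_add, hk2, hl2]
    | neg p _ hp =>
      obtain ⟨k, hk1, hk2⟩ := hp
      refine ⟨-k, ?_, ?_⟩
      · rw [Finsupp.sum_neg_index (by simp), Prod.fst_neg, hk1]
        simp [Finsupp.sum]
      · rw [Finsupp.sum_neg_index (by simp), Prod.snd_neg, hk2]
        simp [Finsupp.sum]
  · rintro ⟨k, rfl, rfl⟩
    have : ((k.sum (fun β n => n • (β : V)), k.sum fun _ n => n) : V × ℤ) =
        k.sum fun β n => n • ((β : V), (1 : ℤ)) := by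
      ext <;> simp [Finsupp.sum, Prod.fst_sum, Prod.snd_sum]
    rw [this]
    refine AddSubgroup.sum_mem _ fun β _ =>
      AddSubgroup.zsmul_mem _ (AddSubgroup.subset_closure ?_) _
    exact ⟨β, β.2, rfl⟩

theorem exists_mem_closure_heightGraph {V : Type*} [AddCommGroup V] {Q : Set V} {v : V}
    (hv : v ∈ AddSubgroup.closure Q) : ∃ h : ℤ, (v, h) ∈ AddSubgroup.closure (heightGraph Q) := by
  induction hv using AddSubgroup.closure_induction with
  | mem v hv => exact ⟨1, AddSubgroup.subset_closure ⟨v, hv, rfl⟩⟩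
  | zero => exact ⟨0, zero_mem _⟩
  | add v w _ _ hv hw =>
    obtain ⟨h, hh⟩ := hv
    obtain ⟨k, hk⟩ := hw
    exact ⟨h + k, add_mem hh hk⟩
  | neg v _ hv =>
    obtain ⟨h, hh⟩ := hv
    exact ⟨-h, neg_mem hh⟩

/-- If the height `∑ kᵢ` of every vanishing combination `∑ kᵢ βᵢ` of elements of `Q` is divisible
by `m`, then the height modulo `m` is defined on the lattice spanned by `Q`; this lattice is free,
so that the negated height lifts to an integer valued additive function. -/
theorem exists_additive_of_dvd_height {V : Type*} [AddCommGroup V] [IsAddTorsionFree V] {Q : Set V}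
    (hQ : Q.Finite) {m : ℤ} (hm : ∀ s, ((0 : V), s) ∈ AddSubgroup.closure (heightGraph Q) → m ∣ s) :
    ∃ n : V → ℤ, (∀ v ∈ AddSubgroup.closure Q, ∀ w ∈ AddSubgroup.closure Q,
      n (v + w) = n v + n w) ∧ ∀ β ∈ Q, m ∣ n β + 1 := by
  classical
  let G := AddSubgroup.closure (heightGraph Q)
  let A := AddSubgroup.closure Q
  let f : G →+ V := (AddMonoidHom.fst V ℤ).comp G.subtype
  have hf : ∀ v ∈ A, ∃ g : G, f g = v := fun v hv => by
    obtain ⟨h, hh⟩ := exists_mem_closure_heightGraph hv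
    exact ⟨⟨_, hh⟩, rfl⟩
  have hfA : ∀ g : G, f g ∈ A := by
    rintro ⟨g, hg⟩
    induction hg using AddSubgroup.closure_induction with
    | mem p hp =>
      obtain ⟨β, hβ, rfl⟩ := hp
      exact AddSubgroup.subset_closure hβ
    | zero => exact zero_mem _
    | add p q _ _ hp hq => exact add_mem hp hq
    | neg p _ hp => exact neg_mem hp
  let f' : G →ₗ[ℤ] A := (f.codRestrict A hfA).toIntLinearMap
  have hf' : Function.Surjective f' := fun ⟨v, hv⟩ => by
    obtain ⟨g, hg⟩ := hf v hv
    exact ⟨g, Subtype.ext hg⟩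
  have : AddGroup.FG A := (AddGroup.fg_iff_addSubgroup_fg _).mpr
    ((AddSubgroup.fg_iff _).mpr ⟨Q, rfl, hQ⟩)
  have : Module.Finite ℤ A := Module.Finite.iff_addGroup_fg.mpr this
  have : Module.Free ℤ A := inferInstance
  obtain ⟨s, hs⟩ := Module.projective_lifting_property f' LinearMap.id hf'
  have hs' : ∀ a : A, ((s a : G) : V × ℤ).1 = a := fun a =>
    congrArg Subtype.val (LinearMap.congr_fun hs a)
  refine ⟨fun v => if hv : v ∈ A then -((s ⟨v, hv⟩ : G) : V × ℤ).2 else 0, ?_, ?_⟩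
  · intro v hv w hw
    beta_reduce
    rw [dif_pos (add_mem hv hw), dif_pos hv, dif_pos hw,
      show (⟨v + w, add_mem hv hw⟩ : A) = ⟨v, hv⟩ + ⟨w, hw⟩ from rfl, map_add]
    simp [add_comm]
  · intro β hβ
    have hβA : β ∈ A := AddSubgroup.subset_closure hβ
    beta_reduce
    rw [dif_pos hβA]
    apply hm
    have h1 : ((β, 1) : V × ℤ) ∈ G := AddSubgroup.subset_closure ⟨β, hβ, rfl⟩
    convert sub_mem h1 (s ⟨β, hβA⟩).2 using 1
    ext
    · simp [hs']
    · simp [sub_eq_neg_add]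

/-- A set of roots no two of which have a root as sum or difference is strongly orthogonal, hence
linearly independent. -/
theorem height_eq_zero_of_stronglyOrthogonal {Q : Set (Module.Dual K H)}
    (hQ : ∀ β ∈ Q, β ≠ 0 ∧ rootSpace H β ≠ ⊥)
    (hadd : ∀ α ∈ Q, ∀ β ∈ Q, α ≠ β → rootSpace H (β + α : Module.Dual K H) = ⊥)
    (hsub : ∀ α ∈ Q, ∀ β ∈ Q, α ≠ β → rootSpace H (β - α : Module.Dual K H) = ⊥)
    {s : ℤ} (hs : ((0 : Module.Dual K H), s) ∈ AddSubgroup.closure (heightGraph Q)) : s = 0 := by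
  obtain ⟨k, hk, rfl⟩ := mem_closure_heightGraph.mp hs
  suffices k = 0 by simp [this]
  ext α
  obtain ⟨c, hc2, hc⟩ := exists_coroot (hQ α α.2).1 (hQ α α.2).2
  have horth : ∀ β : Q, β ≠ α → (β : Module.Dual K H) c = 0 := by
    intro β hβ
    have hne : (α : Module.Dual K H) ≠ β := fun h => hβ (Subtype.ext h.symm)
    obtain ⟨m, hm, -, h⟩ := hc β (hQ β β.2).2
    rw [hm]
    by_contra hm0
    rcases h (by simpa using hm0) with h | h
    · exact h (hsub α α.2 β β.2 hne)
    · exact h (hadd α α.2 β β.2 hne)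
  have h0 := congrArg (fun γ : Module.Dual K H => γ c) hk
  simp only [LinearMap.zero_apply, Finsupp.sum, LinearMap.sum_apply, LinearMap.smul_apply] at h0
  rw [Finset.sum_eq_single α (fun β _ hβ => by rw [horth β hβ, smul_zero])
    (fun h => by simp [Finsupp.notMem_support_iff.mp h]), hc2] at h0
  simpa using h0.symm

/-- A Lie algebra homomorphism that preserves the Cartan subalgebra `H` and acts on the root spaces
of `Q` as the scalar `c ≠ 0` modulo `H` is the identity on `H` and acts on the root space of
`∑ kᵢ βᵢ`, `βᵢ ∈ Q`, as `c ^ ∑ kᵢ`. For a vanishing combination this says `c ^ ∑ kᵢ = 1`. -/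
theorem lieHom_apply_of_mem_rootSpace {Q : Set (Module.Dual K H)}
    (hQ : ∀ β ∈ Q, β ≠ 0 ∧ rootSpace H β ≠ ⊥)
    (hR : ∀ α : Module.Dual K H, α ≠ 0 → rootSpace H α ≠ ⊥ → α ∈ AddSubgroup.closure Q)
    {φ : L →ₗ⁅K⁆ L} (hφ : ∀ x ∈ H, φ x ∈ H) {c : K} (hc : c ≠ 0)
    (hφQ : ∀ β ∈ Q, ∀ z ∈ rootSpace H β, φ z - c • z ∈ H) {α : Module.Dual K H}
    (hαr : rootSpace H α ≠ ⊥) {k : ℤ}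
    (hk : (α, k) ∈ AddSubgroup.closure (heightGraph Q)) :
    ∀ z ∈ rootSpace H α, φ z = c ^ k • z := by
  -- Compare `φ ⁅x, z⁆` and `⁅φ x, φ z⁆` for `x ∈ H` and `z` in a root space of `Q`.
  have hcomp : ∀ β ∈ Q, ∀ x : H, ∀ hx : φ x ∈ H, ∀ z ∈ rootSpace H β,
      (c * (β x - β ⟨φ x, hx⟩)) • z + β x • (φ z - c • z) = 0 := by
    intro β hβ x hx z hz
    have h1 : ⁅(x : L), z⁆ = β x • z := lie_eq_smul_of_mem_rootSpace hz x
    have h2 : ⁅φ x, z⁆ = β ⟨φ x, hx⟩ • z := lie_eq_smul_of_mem_rootSpace hz ⟨φ x, hx⟩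
    have h3 : ⁅φ x, φ z - c • z⁆ = 0 := by
      have := trivial_lie_zero H H ⟨φ x, hx⟩ ⟨_, hφQ β hβ z hz⟩
      exact congrArg Subtype.val this
    have h4 := φ.map_lie (x : L) z
    rw [h1, map_smul, show φ z = c • z + (φ z - c • z) by abel, lie_add, h3, lie_smul, h2] at h4
    rw [add_zero, smul_add] at h4
    rw [mul_sub, sub_smul, ← smul_smul, ← smul_smul, smul_comm c (β x), sub_add_eq_add_sub, h4,
      sub_self]
  -- The two summands lie in the root spaces of `β` and of `0`, so both vanish.
  have hsplit : ∀ β ∈ Q, ∀ x : H, ∀ hx : φ x ∈ H, ∀ z ∈ rootSpace H β,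
      (c * (β x - β ⟨φ x, hx⟩)) • z = 0 ∧ β x • (φ z - c • z) = 0 := by
    intro β hβ x hx z hz
    have h := hcomp β hβ x hx z hz
    have hdis := (iSupIndep_genWeightSpace K H L).pairwiseDisjoint
      (fun h : (β : H → K) = ((0 : Module.Dual K H) : H → K) =>
        (hQ β hβ).1 (DFunLike.coe_injective h))
    have hmem1 : (c * (β x - β ⟨φ x, hx⟩)) • z ∈ rootSpace H β := Submodule.smul_mem _ _ hz
    have hmem2 : (c * (β x - β ⟨φ x, hx⟩)) • z ∈ rootSpace H (0 : Module.Dual K H) := by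
      rw [eq_neg_of_add_eq_zero_left h, mem_rootSpace_zero]
      exact neg_mem (H.smul_mem _ (hφQ β hβ z hz))
    have h0 : (c * (β x - β ⟨φ x, hx⟩)) • z = 0 := by
      have hinf : (c * (β x - β ⟨φ x, hx⟩)) • z ∈
          rootSpace H β ⊓ rootSpace H (0 : Module.Dual K H) :=
        ⟨hmem1, hmem2⟩
      rwa [hdis.eq_bot, LieSubmodule.mem_bot] at hinf
    exact ⟨h0, by rwa [h0, zero_add] at h⟩
  have hφQ' : ∀ β ∈ Q, ∀ z ∈ rootSpace H β, φ z = c • z := by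
    intro β hβ z hz
    obtain ⟨x, hx⟩ : ∃ x, β x ≠ 0 := by
      by_contra! h
      exact (hQ β hβ).1 (LinearMap.ext h)
    rcases smul_eq_zero.mp (hsplit β hβ x (hφ x x.2) z hz).2 with h | h
    · exact absurd h hx
    · exact sub_eq_zero.mp h
  -- Roots of `Q` do not distinguish `x` and `φ x`, and they span the dual of `H`.
  have hφH : ∀ x ∈ H, φ x = x := by
    intro x hx
    have hβ : ∀ β ∈ Q, β (⟨x, hx⟩ - ⟨φ x, hφ x hx⟩ : H) = 0 := by
      intro β hβ
      obtain ⟨z, hz, hz0⟩ := (⟨β, (hQ β hβ).2⟩ : Weight K H L).exists_ne_zero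
      have := (hsplit β hβ ⟨x, hx⟩ (hφ x hx) z hz).1
      rw [smul_eq_zero_iff_left hz0, mul_eq_zero, or_iff_right hc] at this
      rw [map_sub]
      exact this
    have hcl : ∀ γ ∈ AddSubgroup.closure Q, γ (⟨x, hx⟩ - ⟨φ x, hφ x hx⟩ : H) = 0 := by
      intro γ hγ
      induction hγ using AddSubgroup.closure_induction with
      | mem γ h => exact hβ γ h
      | zero => rfl
      | add γ δ _ _ h1 h2 => rw [LinearMap.add_apply, h1, h2, add_zero]
      | neg γ _ h => rw [LinearMap.neg_apply, h, neg_zero]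
    have hker : (⟨x, hx⟩ - ⟨φ x, hφ x hx⟩ : H) ∈ ⨅ χ : Weight K H L, χ.ker := by
      rw [Submodule.mem_iInf]
      intro χ
      by_cases hχ : χ.toLinear = 0
      · simp [hχ, Weight.ker]
      · exact hcl _ (hR χ.toLinear hχ χ.genWeightSpace_ne_bot)
    rw [iInf_ker_weight_eq_bot, Submodule.mem_bot, sub_eq_zero] at hker
    exact (congrArg Subtype.val hker).symm
  have hφE : ∀ e, (e ∈ heightGraph Q ∨ -e ∈ heightGraph Q) →
      e.1 ≠ 0 ∧ rootSpace H e.1 ≠ ⊥ ∧ ∀ z ∈ rootSpace H e.1, φ z = c ^ e.2 • z := by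
    rintro ⟨γ, k⟩ (⟨β, hβ, he⟩ | ⟨β, hβ, he⟩)
    · obtain ⟨rfl, rfl⟩ := Prod.mk.inj he
      exact ⟨(hQ _ hβ).1, (hQ _ hβ).2, by simpa using hφQ' _ hβ⟩
    · obtain ⟨h1, h2⟩ := Prod.mk.inj he
      obtain rfl : γ = -β := by rw [h1]; simp
      obtain rfl : k = -1 := by rw [← neg_neg k]; exact congrArg Neg.neg h2.symm
      refine ⟨neg_ne_zero.mpr (hQ _ hβ).1, rootSpace_neg_ne_bot (hQ _ hβ).2, fun z hz => ?_⟩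
      obtain ⟨x, hx, y, hy, hxy⟩ := exists_lie_ne_zero (hQ _ hβ).1 (hQ _ hβ).2
        (rootSpace_neg_ne_bot (hQ _ hβ).2)
        (by rw [add_neg_cancel]; exact rootSpace_zero_ne_bot (hQ _ hβ).1)
      have hy0 : y ≠ 0 := by rintro rfl; simp at hxy
      have hxyH : ⁅x, y⁆ ∈ H := by
        rw [← mem_rootSpace_zero]
        have := lie_mem_genWeightSpace_of_mem_genWeightSpace hx hy
        rwa [show ((β : H → K) + (-β : Module.Dual K H)) = (0 : Module.Dual K H) by
          ext; simp] at this
      -- `φ y` is again in the root space, because `φ` is the identity on `H`.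
      have hstab : φ y ∈ rootSpace H (-β : Module.Dual K H) := by
        refine (mem_genWeightSpace L _ _).mpr fun w => ⟨1, ?_⟩
        have h1 : ⁅(w : L), y⁆ = (-β : Module.Dual K H) w • y := lie_eq_smul_of_mem_rootSpace hy w
        have h2 := φ.map_lie (w : L) y
        rw [h1, map_smul, hφH w w.2] at h2
        rw [pow_one, LinearMap.sub_apply, toEnd_apply_apply, LieSubalgebra.coe_bracket_of_module,
          ← h2]
        simp
      obtain ⟨d, hd⟩ := exists_smul_eq_of_mem_rootSpace (neg_ne_zero.mpr (hQ _ hβ).1) hy hy0 hstab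
      have hcd := φ.map_lie x y
      rw [hφH _ hxyH, hφQ' _ hβ _ hx, hd, smul_lie, lie_smul, smul_smul] at hcd
      have hcd1 : c * d = 1 := by
        have : (1 - c * d) • ⁅x, y⁆ = 0 := by rw [sub_smul, one_smul, ← hcd, sub_self]
        rw [smul_eq_zero_iff_left hxy, sub_eq_zero] at this
        exact this.symm
      obtain ⟨t, rfl⟩ := exists_smul_eq_of_mem_rootSpace (neg_ne_zero.mpr (hQ _ hβ).1) hy hy0 hz
      rw [map_smul, hd, zpow_neg, zpow_one, eq_inv_of_mul_eq_one_right hcd1, smul_comm]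
  have := weight_induction (H := H) (E := heightGraph Q)
    (P := fun p => (p.1 = 0 → c ^ p.2 = 1) ∧ ∀ z ∈ rootSpace H p.1, φ z = c ^ p.2 • z)
    (by rintro _ ⟨β, hβ, rfl⟩; exact hQ β hβ)
    ⟨by simp, fun z hz => by simpa using hφH z (mem_rootSpace_zero.mp hz)⟩ ?_ hk hαr
  · exact this.2
  rintro ⟨x, k⟩ ⟨b, l⟩ he hp hpe ⟨h0, h⟩
  obtain ⟨hb0, hbr, hb⟩ := hφE _ he
  simp only [Prod.mk_add_mk] at hp hpe h0 h hb hb0 hbr ⊢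
  obtain ⟨u, hu, w, hw, huw⟩ := exists_lie_ne_zero hb0 hbr hp (by rwa [add_comm])
  have huw' : ⁅u, w⁆ ∈ rootSpace H (x + b : Module.Dual K H) := by
    rw [add_comm]
    exact lie_mem_genWeightSpace_of_mem_genWeightSpace hu hw
  have hφuw : φ ⁅u, w⁆ = c ^ (k + l) • ⁅u, w⁆ := by
    rw [φ.map_lie, hb u hu, h w hw, smul_lie, lie_smul, smul_smul, zpow_add₀ hc, mul_comm]
  by_cases hxb : x + b = 0
  · have hone : c ^ (k + l) = 1 := by
      rw [hxb] at huw'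
      rw [hφH _ (mem_rootSpace_zero.mp huw')] at hφuw
      have : (1 - c ^ (k + l)) • ⁅u, w⁆ = 0 := by rw [sub_smul, one_smul, ← hφuw, sub_self]
      rw [smul_eq_zero_iff_left huw, sub_eq_zero] at this
      exact this.symm
    refine ⟨fun _ => hone, fun z hz => ?_⟩
    rw [hxb] at hz
    rw [hone, one_smul, hφH z (mem_rootSpace_zero.mp hz)]
  · refine ⟨fun h => absurd h hxb, fun z hz => ?_⟩
    obtain ⟨t, rfl⟩ := exists_smul_eq_of_mem_rootSpace hxb huw' huw hz
    rw [map_smul, hφuw, smul_comm]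

end Characters

/-! ### Diagonal endomorphisms -/

section Diagonal

open LieAlgebra LieModule LieAlgebra.IsKilling

variable {K L : Type*} [Field K] [CharZero K] [LieRing L] [LieAlgebra K L]
  [IsKilling K L] [FiniteDimensional K L]
  {H : LieSubalgebra K L} [H.IsCartanSubalgebra] [IsTriangularizable K H L]

theorem bilinMap_ext_rootSpace {M : Type*} [AddCommGroup M] [Module K M] {B C : L →ₗ[K] L →ₗ[K] M}
    (h : ∀ α β : Module.Dual K H, ∀ x ∈ rootSpace H α, ∀ y ∈ rootSpace H β, B x y = C x y) :
    B = C :=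
  linearMap_ext_rootSpace (H := H) fun α x hx =>
    linearMap_ext_rootSpace (H := H) fun β y hy => h α β x hx y hy

theorem lie_mem_rootSpace_add {α β : Module.Dual K H} {x y : L} (hx : x ∈ rootSpace H α)
    (hy : y ∈ rootSpace H β) : ⁅x, y⁆ ∈ rootSpace H (α + β : Module.Dual K H) :=
  lie_mem_genWeightSpace_of_mem_genWeightSpace hx hy

theorem diagonal_lie_eq_of_mul {f : Module.Dual K H → K} {T : L →ₗ[K] L}
    (hT : ∀ α : Module.Dual K H, ∀ x ∈ rootSpace H α, T x = f α • x)
    (hf : ∀ α β : Module.Dual K H, rootSpace H α ≠ ⊥ → rootSpace H β ≠ ⊥ →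
      f (α + β) = f α * f β) (x y : L) : T ⁅x, y⁆ = ⁅T x, T y⁆ := by
  let b : L →ₗ[K] L →ₗ[K] L := LinearMap.mk₂ K (fun x y => ⁅x, y⁆) add_lie smul_lie lie_add
    fun c x y => lie_smul c x y
  suffices b.compr₂ T = b.compl₁₂ T T from LinearMap.congr_fun₂ this x y
  refine bilinMap_ext_rootSpace (H := H) fun α β x hx y hy => ?_
  change T ⁅x, y⁆ = ⁅T x, T y⁆
  rw [hT α x hx, hT β y hy, hT _ _ (lie_mem_rootSpace_add hx hy)]
  by_cases hα : rootSpace H α = ⊥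
  · rw [hα, LieSubmodule.mem_bot] at hx
    simp [hx]
  by_cases hβ : rootSpace H β = ⊥
  · rw [hβ, LieSubmodule.mem_bot] at hy
    simp [hy]
  rw [hf α β hα hβ, smul_lie, lie_smul, smul_smul]

theorem diagonal_lie_eq_of_add {f : Module.Dual K H → K} {T : L →ₗ[K] L}
    (hT : ∀ α : Module.Dual K H, ∀ x ∈ rootSpace H α, T x = f α • x)
    (hf : ∀ α β : Module.Dual K H, rootSpace H α ≠ ⊥ → rootSpace H β ≠ ⊥ →
      f (α + β) = f α + f β) (x y : L) : T ⁅x, y⁆ = ⁅x, T y⁆ + ⁅T x, y⁆ := by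
  let b : L →ₗ[K] L →ₗ[K] L := LinearMap.mk₂ K (fun x y => ⁅x, y⁆) add_lie smul_lie lie_add
    fun c x y => lie_smul c x y
  suffices b.compr₂ T = b.compl₂ T + b.comp T from LinearMap.congr_fun₂ this x y
  refine bilinMap_ext_rootSpace (H := H) fun α β x hx y hy => ?_
  change T ⁅x, y⁆ = ⁅x, T y⁆ + ⁅T x, y⁆
  rw [hT α x hx, hT β y hy, hT _ _ (lie_mem_rootSpace_add hx hy)]
  by_cases hα : rootSpace H α = ⊥
  · rw [hα, LieSubmodule.mem_bot] at hx
    simp [hx]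
  by_cases hβ : rootSpace H β = ⊥
  · rw [hβ, LieSubmodule.mem_bot] at hy
    simp [hy]
  rw [hf α β hα hβ, smul_lie, lie_smul, add_smul, add_comm]

/-- The Cartan subalgebra and the root spaces of `±β`, for `β` in a set `Q` generating the root
lattice, generate the Lie algebra. -/
theorem lieSubalgebra_eq_top {Q : Set (Module.Dual K H)}
    (hQ : ∀ β ∈ Q, β ≠ 0 ∧ rootSpace H β ≠ ⊥)
    (hR : ∀ α : Module.Dual K H, α ≠ 0 → rootSpace H α ≠ ⊥ → α ∈ AddSubgroup.closure Q)
    {A : LieSubalgebra K L} (hH : H ≤ A)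
    (hpos : ∀ β ∈ Q, ∀ z ∈ rootSpace H β, z ∈ A)
    (hneg : ∀ β ∈ Q, ∀ z ∈ rootSpace H (-β : Module.Dual K H), z ∈ A) : A = ⊤ := by
  rw [← LieSubalgebra.toSubmodule_inj, LieSubalgebra.top_toSubmodule]
  refine submodule_eq_top_of_rootSpace_le (H := H) hH fun α hα hαr => ?_
  obtain ⟨k, hk⟩ := exists_mem_closure_heightGraph (hR α hα hαr)
  suffices ∀ z ∈ rootSpace H α, z ∈ A from fun z hz => this z hz
  have := weight_induction (H := H) (E := heightGraph Q)
    (P := fun p => ∀ z ∈ rootSpace H p.1, z ∈ A)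
    (by rintro _ ⟨β, hβ, rfl⟩; exact hQ β hβ)
    (fun z hz => hH (mem_rootSpace_zero.mp hz)) ?_ hk hαr
  · exact this
  rintro ⟨x, k⟩ ⟨b, l⟩ he hp hpe h z hz
  have hb : b ≠ 0 ∧ rootSpace H b ≠ ⊥ ∧ ∀ z ∈ rootSpace H b, z ∈ A := by
    rcases he with ⟨β, hβ, he⟩ | ⟨β, hβ, he⟩
    · obtain ⟨rfl, rfl⟩ := Prod.mk.inj he
      exact ⟨(hQ _ hβ).1, (hQ _ hβ).2, hpos _ hβ⟩
    · obtain ⟨h1, h2⟩ := Prod.mk.inj he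
      obtain rfl : b = -β := by rw [h1]; simp
      exact ⟨neg_ne_zero.mpr (hQ _ hβ).1, rootSpace_neg_ne_bot (hQ _ hβ).2, hneg _ hβ⟩
  obtain ⟨hb0, hbr, hb⟩ := hb
  simp only [Prod.mk_add_mk] at hp hpe h hz ⊢
  by_cases hxb : x + b = 0
  · rw [hxb] at hz
    exact hH (mem_rootSpace_zero.mp hz)
  obtain ⟨u, hu, w, hw, huw⟩ := exists_lie_ne_zero hb0 hbr hp (by rwa [add_comm])
  have huw' : ⁅u, w⁆ ∈ rootSpace H (x + b : Module.Dual K H) := by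
    rw [add_comm]
    exact lie_mem_rootSpace_add hu hw
  obtain ⟨t, rfl⟩ := exists_smul_eq_of_mem_rootSpace hxb huw' huw hz
  exact A.smul_mem t (A.lie_mem (hb u hu) (h w hw))

theorem finite_weights : {α : Module.Dual K H | rootSpace H α ≠ ⊥}.Finite := by
  refine (Set.finite_range (Weight.toLinear K H L)).subset fun α hα => ⟨⟨α, hα⟩, ?_⟩
  ext
  rfl

end Diagonal

/-! ### The complexification and its conjugation -/

section Complexification

variable {g₀ : Type*} [LieRing g₀] [LieAlgebra ℝ g₀]

/-- The real part of an element of `ℂ ⊗ g₀`. -/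
noncomputable def rePart : (ℂ ⊗[ℝ] g₀) →ₗ[ℝ] g₀ :=
  (TensorProduct.lid ℝ g₀).toLinearMap ∘ₗ LinearMap.rTensor g₀ Complex.reLm

/-- The imaginary part of an element of `ℂ ⊗ g₀`. -/
noncomputable def imPart : (ℂ ⊗[ℝ] g₀) →ₗ[ℝ] g₀ :=
  (TensorProduct.lid ℝ g₀).toLinearMap ∘ₗ LinearMap.rTensor g₀ Complex.imLm

theorem rePart_tmul (c : ℂ) (x : g₀) : rePart (c ⊗ₜ[ℝ] x) = c.re • x := by simp [rePart]

theorem imPart_tmul (c : ℂ) (x : g₀) : imPart (c ⊗ₜ[ℝ] x) = c.im • x := by simp [imPart]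

@[simp]
theorem rePart_cplx (x y : g₀) : rePart (cplx x y) = x := by simp [cplx, rePart_tmul]

@[simp]
theorem imPart_cplx (x y : g₀) : imPart (cplx x y) = y := by simp [cplx, imPart_tmul]

theorem cplx_add (x y x' y' : g₀) : cplx x y + cplx x' y' = cplx (x + x') (y + y') := by
  simp only [cplx, TensorProduct.tmul_add]
  abel

theorem cplx_sub (x y x' y' : g₀) : cplx x y - cplx x' y' = cplx (x - x') (y - y') := by
  simp only [cplx, TensorProduct.tmul_sub]
  abel

theorem tmul_eq_cplx (c : ℂ) (x : g₀) : c ⊗ₜ[ℝ] x = cplx (c.re • x) (c.im • x) := by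
  simp only [cplx, ← TensorProduct.smul_tmul, ← TensorProduct.add_tmul]
  congr 1
  apply Complex.ext <;> simp

theorem cplx_rePart_imPart (z : ℂ ⊗[ℝ] g₀) : cplx (rePart z) (imPart z) = z := by
  induction z using TensorProduct.induction_on with
  | zero => simp [cplx]
  | tmul c x => rw [rePart_tmul, imPart_tmul, tmul_eq_cplx]
  | add z w hz hw => rw [map_add, map_add, ← cplx_add, hz, hw]

theorem exists_eq_cplx (z : ℂ ⊗[ℝ] g₀) : ∃ x y, z = cplx x y :=
  ⟨_, _, (cplx_rePart_imPart z).symm⟩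

theorem cplx_inj {x y x' y' : g₀} : cplx x y = cplx x' y' ↔ x = x' ∧ y = y' := by
  refine ⟨fun h => ⟨?_, ?_⟩, fun h => by rw [h.1, h.2]⟩
  · simpa using congrArg rePart h
  · simpa using congrArg imPart h

theorem one_tmul_eq_cplx (x : g₀) : (1 : ℂ) ⊗ₜ[ℝ] x = cplx x 0 := by simp [cplx]

theorem smul_cplx (c : ℂ) (x y : g₀) :
    c • cplx x y = cplx (c.re • x - c.im • y) (c.im • x + c.re • y) := by
  have : c • cplx x y = c ⊗ₜ[ℝ] x + (c * Complex.I) ⊗ₜ[ℝ] y := by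
    simp [cplx, TensorProduct.smul_tmul']
  rw [this, tmul_eq_cplx, tmul_eq_cplx, cplx_add]
  simp [sub_eq_add_neg]

theorem I_smul_cplx (x y : g₀) : Complex.I • cplx x y = cplx (-y) x := by
  rw [smul_cplx]; simp

theorem lie_cplx (a b x y : g₀) :
    ⁅cplx a b, cplx x y⁆ = cplx (⁅a, x⁆ - ⁅b, y⁆) (⁅a, y⁆ + ⁅b, x⁆) := by
  simp only [cplx, add_lie, lie_add, LieAlgebra.ExtendScalars.bracket_tmul, TensorProduct.tmul_sub,
    TensorProduct.tmul_add, one_mul, mul_one, Complex.I_mul_I, TensorProduct.neg_tmul]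
  abel

theorem baseChange_cplx (T : g₀ →ₗ[ℝ] g₀) (x y : g₀) :
    T.baseChange ℂ (cplx x y) = cplx (T x) (T y) := by
  simp [cplx]

theorem conj_tmul (c : ℂ) (x : g₀) :
    conj (c ⊗ₜ[ℝ] x) = (starRingEnd ℂ c) ⊗ₜ[ℝ] x := rfl

@[simp]
theorem conj_cplx (x y : g₀) : conj (cplx x y) = cplx x (-y) := by
  simp [cplx, conj_tmul, TensorProduct.neg_tmul, TensorProduct.tmul_neg]

@[simp]
theorem conj_conj (z : ℂ ⊗[ℝ] g₀) : conj (conj z) = z := by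
  obtain ⟨x, y, rfl⟩ := exists_eq_cplx z
  simp

theorem conj_smul (c : ℂ) (z : ℂ ⊗[ℝ] g₀) : conj (c • z) = starRingEnd ℂ c • conj z := by
  obtain ⟨x, y, rfl⟩ := exists_eq_cplx z
  simp only [smul_cplx, conj_cplx, Complex.conj_re, Complex.conj_im, cplx_inj]
  constructor
  · simp
  · simp only [smul_neg, neg_add, neg_smul]

theorem conj_eq_self_iff {z : ℂ ⊗[ℝ] g₀} : conj z = z ↔ ∃ x : g₀, (1 : ℂ) ⊗ₜ[ℝ] x = z := by
  constructor
  · intro h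
    obtain ⟨x, y, rfl⟩ := exists_eq_cplx z
    rw [conj_cplx, cplx_inj] at h
    have : IsAddTorsionFree g₀ := .of_isTorsionFree ℝ g₀
    have hy : y = 0 := self_eq_neg.mp h.2.symm
    exact ⟨x, by rw [hy, one_tmul_eq_cplx]⟩
  · rintro ⟨x, rfl⟩
    rw [one_tmul_eq_cplx, conj_cplx, neg_zero]

/-- A complex linear map commuting with the conjugation is the complexification of a real one. -/
theorem exists_baseChange_eq {T : (ℂ ⊗[ℝ] g₀) →ₗ[ℂ] (ℂ ⊗[ℝ] g₀)}
    (hT : ∀ z, T (conj z) = conj (T z)) : ∃ S : g₀ →ₗ[ℝ] g₀, S.baseChange ℂ = T := by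
  have h : ∀ x : g₀, T ((1 : ℂ) ⊗ₜ[ℝ] x) = (1 : ℂ) ⊗ₜ[ℝ] rePart (T ((1 : ℂ) ⊗ₜ[ℝ] x)) := by
    intro x
    have hx : conj ((1 : ℂ) ⊗ₜ[ℝ] x) = (1 : ℂ) ⊗ₜ[ℝ] x := conj_eq_self_iff.mpr ⟨x, rfl⟩
    have := hT ((1 : ℂ) ⊗ₜ[ℝ] x)
    rw [hx] at this
    obtain ⟨y, hy⟩ := conj_eq_self_iff.mp this.symm
    rw [← hy, rePart_tmul]
    simp
  refine ⟨rePart ∘ₗ (T.restrictScalars ℝ) ∘ₗ (TensorProduct.mk ℝ ℂ g₀ 1), ?_⟩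
  ext x
  simp only [TensorProduct.AlgebraTensorModule.curry_apply, TensorProduct.curry_apply,
    LinearMap.coe_restrictScalars, LinearMap.baseChange_tmul]
  exact (h x).symm

theorem cplx_mem_complexify {t₀ : LieSubalgebra ℝ g₀} {x y : g₀} :
    cplx x y ∈ complexify t₀ ↔ x ∈ t₀ ∧ y ∈ t₀ := by
  constructor
  · suffices ∀ z ∈ t₀.toSubmodule.baseChange ℂ, rePart z ∈ t₀ ∧ imPart z ∈ t₀ by
      intro h
      simpa using this _ h
    intro z hz
    rw [Submodule.baseChange_eq_span] at hz
    induction hz using Submodule.span_induction with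
    | mem z hz =>
      obtain ⟨x, hx, rfl⟩ := hz
      rw [TensorProduct.mk_apply, one_tmul_eq_cplx, rePart_cplx, imPart_cplx]
      exact ⟨hx, zero_mem _⟩
    | zero => simp
    | add z w _ _ hz hw =>
      rw [map_add, map_add]
      exact ⟨add_mem hz.1 hw.1, add_mem hz.2 hw.2⟩
    | smul c z _ hz =>
      rw [← cplx_rePart_imPart z, smul_cplx, rePart_cplx, imPart_cplx]
      exact ⟨sub_mem (t₀.smul_mem _ hz.1) (t₀.smul_mem _ hz.2),
        add_mem (t₀.smul_mem _ hz.1) (t₀.smul_mem _ hz.2)⟩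
  · rintro ⟨hx, hy⟩
    exact add_mem (Submodule.tmul_mem_baseChange_of_mem _ hx)
      (Submodule.tmul_mem_baseChange_of_mem _ hy)

theorem conj_mem_complexify {t₀ : LieSubalgebra ℝ g₀} {z : ℂ ⊗[ℝ] g₀}
    (hz : z ∈ complexify t₀) : conj z ∈ complexify t₀ := by
  obtain ⟨x, y, rfl⟩ := exists_eq_cplx z
  rw [conj_cplx]
  rw [cplx_mem_complexify] at hz ⊢
  exact ⟨hz.1, neg_mem hz.2⟩

end Complexification

/-! ### Compact Lie algebras -/

section Compact

open LieAlgebra LieModule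

variable {u₀ : Type*} [LieRing u₀] [LieAlgebra ℝ u₀] [FiniteDimensional ℝ u₀]

theorem killingForm_lie_left (x y z : u₀) :
    killingForm ℝ u₀ ⁅x, y⁆ z = - killingForm ℝ u₀ y ⁅x, z⁆ :=
  traceForm_apply_lie_apply' ℝ u₀ u₀ x y z

theorem killingForm_self_lie (x y : u₀) : killingForm ℝ u₀ ⁅x, y⁆ y = 0 := by
  have h := killingForm_lie_left x y y
  have h' : killingForm ℝ u₀ y ⁅x, y⁆ = killingForm ℝ u₀ ⁅x, y⁆ y := traceForm_comm ℝ u₀ u₀ _ _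
  linarith

theorem eq_zero_of_killingForm_self_eq_zero
    (hu₀ : ∀ x : u₀, x ≠ 0 → killingForm ℝ u₀ x x < 0) {x : u₀}
    (hx : killingForm ℝ u₀ x x = 0) : x = 0 := by
  by_contra h
  exact (hu₀ x h).ne hx

theorem isKilling_of_neg (hu₀ : ∀ x : u₀, x ≠ 0 → killingForm ℝ u₀ x x < 0) :
    IsKilling ℝ u₀ := by
  refine ⟨(LieSubmodule.eq_bot_iff _).mpr fun x hx => ?_⟩
  rw [LieIdeal.mem_killingCompl] at hx
  exact eq_zero_of_killingForm_self_eq_zero hu₀ (hx x (LieSubmodule.mem_top x))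

theorem isKilling_complexification (hu₀ : ∀ x : u₀, x ≠ 0 → killingForm ℝ u₀ x x < 0) :
    IsKilling ℂ (ℂ ⊗[ℝ] u₀) := by
  refine ⟨(LieSubmodule.eq_bot_iff _).mpr fun z hz => ?_⟩
  rw [LieIdeal.mem_killingCompl] at hz
  obtain ⟨x, y, rfl⟩ := exists_eq_cplx z
  have h : ∀ w, (killingForm ℝ u₀ w x : ℂ) + killingForm ℝ u₀ w y * Complex.I = 0 := by
    intro w
    have := hz ((1 : ℂ) ⊗ₜ[ℝ] w) (LieSubmodule.mem_top _)
    have hbc : killingForm ℂ (ℂ ⊗[ℝ] u₀) = LinearMap.BilinForm.baseChange ℂ (killingForm ℝ u₀) :=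
      traceForm_baseChange ℝ u₀ u₀ ℂ
    rw [hbc, cplx, map_add,
      LinearMap.BilinForm.baseChange_tmul, LinearMap.BilinForm.baseChange_tmul] at this
    simpa using this
  have hx := congrArg Complex.re (h x)
  have hy := congrArg Complex.im (h y)
  simp only [Complex.add_re, Complex.ofReal_re, Complex.mul_re, Complex.I_re, mul_zero,
    Complex.ofReal_im, Complex.I_im, mul_one, sub_self, add_zero, Complex.zero_re] at hx
  simp only [Complex.add_im, Complex.ofReal_im, Complex.mul_im, Complex.ofReal_re, Complex.I_im,
    mul_one, Complex.I_re, mul_zero, add_zero, zero_add, Complex.zero_im] at hy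
  rw [eq_zero_of_killingForm_self_eq_zero hu₀ hx, eq_zero_of_killingForm_self_eq_zero hu₀ hy]
  simp [cplx]

/-- A maximal abelian subalgebra is its own centralizer. -/
theorem mem_of_forall_lie_eq_zero {t₀ : LieSubalgebra ℝ u₀} [IsLieAbelian t₀]
    (ht₀ : ∀ s : LieSubalgebra ℝ u₀, IsLieAbelian s → t₀ ≤ s → s = t₀) {z : u₀}
    (hz : ∀ a ∈ t₀, ⁅a, z⁆ = 0) : z ∈ t₀ := by
  have hab : ∀ a ∈ t₀, ∀ b ∈ t₀, ⁅a, b⁆ = 0 := fun a ha b hb =>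
    congrArg Subtype.val (trivial_lie_zero t₀ t₀ ⟨a, ha⟩ ⟨b, hb⟩)
  have hbr : ∀ x ∈ t₀.toSubmodule ⊔ Submodule.span ℝ {z},
      ∀ y ∈ t₀.toSubmodule ⊔ Submodule.span ℝ {z},
      ⁅x, y⁆ = 0 := by
    intro x hx y hy
    obtain ⟨a, ha, w, hw, rfl⟩ := Submodule.mem_sup.mp hx
    obtain ⟨b, hb, v, hv, rfl⟩ := Submodule.mem_sup.mp hy
    obtain ⟨c, rfl⟩ := Submodule.mem_span_singleton.mp hw
    obtain ⟨d, rfl⟩ := Submodule.mem_span_singleton.mp hv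
    have hzb : ⁅z, b⁆ = 0 := by rw [← lie_skew, hz b hb, neg_zero]
    simp [hab a ha b hb, hz a ha, hzb]
  let s : LieSubalgebra ℝ u₀ :=
    { t₀.toSubmodule ⊔ Submodule.span ℝ {z} with
      lie_mem' := fun {x y} hx hy => by
        change ⁅x, y⁆ ∈ t₀.toSubmodule ⊔ Submodule.span ℝ {z}
        rw [hbr x hx y hy]
        exact zero_mem _ }
  have hs : IsLieAbelian s := ⟨fun x y => Subtype.ext (hbr x x.2 y y.2)⟩
  have hle : t₀ ≤ s := fun a ha =>
    (le_sup_left : t₀.toSubmodule ≤ t₀.toSubmodule ⊔ Submodule.span ℝ {z}) ha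
  rw [← ht₀ s hs hle]
  exact (le_sup_right : Submodule.span ℝ {z} ≤ t₀.toSubmodule ⊔ Submodule.span ℝ {z})
    (Submodule.mem_span_singleton_self z)

/-- In a compact Lie algebra `ad a` is skew for a definite form, so that `(ad a)² z = 0` forces
`(ad a) z = 0`: a maximal abelian subalgebra is its own normalizer. -/
theorem mem_of_forall_lie_mem (hu₀ : ∀ x : u₀, x ≠ 0 → killingForm ℝ u₀ x x < 0)
    {t₀ : LieSubalgebra ℝ u₀} [IsLieAbelian t₀]
    (ht₀ : ∀ s : LieSubalgebra ℝ u₀, IsLieAbelian s → t₀ ≤ s → s = t₀) {z : u₀}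
    (hz : ∀ a ∈ t₀, ⁅a, z⁆ ∈ t₀) : z ∈ t₀ := by
  refine mem_of_forall_lie_eq_zero ht₀ fun a ha => eq_zero_of_killingForm_self_eq_zero hu₀ ?_
  have h0 : ⁅a, ⁅a, z⁆⁆ = 0 :=
    congrArg Subtype.val (trivial_lie_zero t₀ t₀ ⟨a, ha⟩ ⟨_, hz a ha⟩)
  rw [killingForm_lie_left, h0, map_zero, neg_zero]

theorem isCartanSubalgebra_complexify (hu₀ : ∀ x : u₀, x ≠ 0 → killingForm ℝ u₀ x x < 0)
    {t₀ : LieSubalgebra ℝ u₀} [IsLieAbelian t₀]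
    (ht₀ : ∀ s : LieSubalgebra ℝ u₀, IsLieAbelian s → t₀ ≤ s → s = t₀) :
    (complexify t₀).IsCartanSubalgebra where
  nilpotent := inferInstance
  self_normalizing := by
    refine le_antisymm (fun z hz => ?_) (LieSubalgebra.le_normalizer _)
    obtain ⟨x, y, rfl⟩ := exists_eq_cplx z
    rw [LieSubalgebra.mem_normalizer_iff'] at hz
    have h : ∀ a ∈ t₀, ⁅a, x⁆ ∈ t₀ ∧ ⁅a, y⁆ ∈ t₀ := by
      intro a ha
      have := hz (cplx a 0) (cplx_mem_complexify.mpr ⟨ha, zero_mem _⟩)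
      rw [lie_cplx, cplx_mem_complexify] at this
      simpa using this
    rw [cplx_mem_complexify]
    exact ⟨mem_of_forall_lie_mem hu₀ ht₀ fun a ha => (h a ha).1,
      mem_of_forall_lie_mem hu₀ ht₀ fun a ha => (h a ha).2⟩

/-- The roots are purely imaginary on `t₀`, so that the conjugation maps the root space of `α` to
the root space of `-α`. -/
theorem conj_mem_rootSpace (hu₀ : ∀ x : u₀, x ≠ 0 → killingForm ℝ u₀ x x < 0)
    {t₀ : LieSubalgebra ℝ u₀} [IsLieAbelian t₀]
    (ht₀ : ∀ s : LieSubalgebra ℝ u₀, IsLieAbelian s → t₀ ≤ s → s = t₀)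
    {α : Module.Dual ℂ (complexify t₀)} {z : ℂ ⊗[ℝ] u₀}
    (hz : z ∈ rootSpace (complexify t₀) α) :
    conj z ∈ rootSpace (complexify t₀) (-α : Module.Dual ℂ (complexify t₀)) := by
  have := isCartanSubalgebra_complexify hu₀ ht₀
  have := isKilling_complexification hu₀
  by_cases hz0 : z = 0
  · rw [hz0, map_zero]
    exact zero_mem _
  have him : ∀ a (ha : a ∈ t₀),
      (α ⟨cplx a 0, cplx_mem_complexify.mpr ⟨ha, zero_mem _⟩⟩).re = 0 := by
    intro a ha
    have h : ⁅cplx a 0, z⁆ = _ := IsKilling.lie_eq_smul_of_mem_rootSpace hz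
      ⟨cplx a 0, cplx_mem_complexify.mpr ⟨ha, zero_mem _⟩⟩
    obtain ⟨x, y, rfl⟩ := exists_eq_cplx z
    rw [lie_cplx, smul_cplx, cplx_inj] at h
    simp only [zero_lie, sub_zero, add_zero] at h
    generalize α ⟨cplx a 0, cplx_mem_complexify.mpr ⟨ha, zero_mem _⟩⟩ = c at h ⊢
    have hx := killingForm_self_lie a x
    have hy := killingForm_self_lie a y
    have hxy : killingForm ℝ u₀ x y = killingForm ℝ u₀ y x := traceForm_comm ℝ u₀ u₀ _ _
    rw [h.1] at hx
    rw [h.2] at hy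
    simp only [map_sub, map_add, map_smul, LinearMap.sub_apply, LinearMap.add_apply,
      LinearMap.smul_apply, smul_eq_mul] at hx hy
    have hsum : c.re * (killingForm ℝ u₀ x x + killingForm ℝ u₀ y y) = 0 := by
      rw [hxy] at hy
      linarith
    refine (mul_eq_zero.mp hsum).resolve_right fun h0 => hz0 ?_
    have hle : ∀ w : u₀, killingForm ℝ u₀ w w ≤ 0 := fun w => by
      by_cases hw : w = 0
      · simp [hw]
      · exact (hu₀ w hw).le
    have hx0 := eq_zero_of_killingForm_self_eq_zero hu₀ (x := x) (by linarith [hle x, hle y])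
    have hy0 := eq_zero_of_killingForm_self_eq_zero hu₀ (x := y) (by linarith [hle x, hle y])
    simp [hx0, hy0, cplx]
  have hconj : ∀ w : complexify t₀, starRingEnd ℂ (α ⟨conj w, conj_mem_complexify w.2⟩) = -α w := by
    rintro ⟨w, hw⟩
    obtain ⟨a, b, rfl⟩ := exists_eq_cplx w
    obtain ⟨ha, hb⟩ := cplx_mem_complexify.mp hw
    set a' : complexify t₀ := ⟨cplx a 0, cplx_mem_complexify.mpr ⟨ha, zero_mem _⟩⟩
    set b' : complexify t₀ := ⟨cplx b 0, cplx_mem_complexify.mpr ⟨hb, zero_mem _⟩⟩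
    have h1 : (⟨cplx a b, hw⟩ : complexify t₀) = a' + Complex.I • b' := by
      apply Subtype.ext
      change cplx a b = cplx a 0 + Complex.I • cplx b 0
      rw [I_smul_cplx, cplx_add]
      simp
    have h2 : (⟨conj (cplx a b), conj_mem_complexify hw⟩ : complexify t₀) =
        a' - Complex.I • b' := by
      apply Subtype.ext
      change conj (cplx a b) = cplx a 0 - Complex.I • cplx b 0
      rw [conj_cplx, I_smul_cplx, cplx_sub]
      simp
    have ha' := him a ha
    have hb' := him b hb
    change (α a').re = 0 at ha'
    change (α b').re = 0 at hb'
    rw [h2, h1, map_sub, map_add, map_smul]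
    apply Complex.ext <;> simp [ha', hb']
  refine (mem_genWeightSpace _ _ _).mpr fun w => ⟨1, ?_⟩
  have h : ⁅conj (w : ℂ ⊗[ℝ] u₀), z⁆ = _ := IsKilling.lie_eq_smul_of_mem_rootSpace hz
    ⟨conj w, conj_mem_complexify w.2⟩
  have h' := congrArg conj h
  rw [LieHom.map_lie, conj_conj, conj_smul, hconj] at h'
  rw [pow_one, LinearMap.sub_apply, toEnd_apply_apply, LieSubalgebra.coe_bracket_of_module, h']
  simp

end Compact

/-! ### The exponential of a derivation -/

section Exponential

attribute [local instance] Matrix.linftyOpNormedRing Matrix.linftyOpNormedAlgebra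

variable {V : Type*} [AddCommGroup V] [Module ℝ V] [FiniteDimensional ℝ V]

theorem endExp_baseChange_apply {A : V →ₗ[ℝ] V} {c : ℂ} {z : ℂ ⊗[ℝ] V}
    (h : A.baseChange ℂ z = c • z) : (endExp A).baseChange ℂ z = Complex.exp c • z := by
  let b := Module.finBasis ℝ V
  let M := LinearMap.toMatrix b b A
  let bC := b.baseChange ℂ
  have hpow : ∀ n : ℕ, (Matrix.toLin b b (M ^ n)).baseChange ℂ z = c ^ n • z := by
    intro n
    induction n with
    | zero => simp
    | succ n ih =>
      rw [pow_succ, Matrix.toLin_mul b b b, Matrix.toLin_toMatrix, LinearMap.baseChange_comp,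
        LinearMap.comp_apply, h, map_smul, ih, smul_smul, pow_succ']
  let Φ : Matrix (Fin (Module.finrank ℝ V)) (Fin (Module.finrank ℝ V)) ℝ →ₗ[ℝ] (ℂ ⊗[ℝ] V) :=
    { toFun := fun N => (Matrix.toLin b b N).baseChange ℂ z
      map_add' := fun N N' => by rw [map_add, LinearMap.baseChange_add, LinearMap.add_apply]
      map_smul' := fun r N => by
        rw [map_smul, LinearMap.baseChange_smul, LinearMap.smul_apply, RingHom.id_apply] }
  apply bC.ext_elem
  intro i
  let Ψ : Matrix (Fin (Module.finrank ℝ V)) (Fin (Module.finrank ℝ V)) ℝ →ₗ[ℝ] ℂ :=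
    ((bC.coord i).restrictScalars ℝ) ∘ₗ Φ
  have hΨ : Continuous Ψ := Ψ.continuous_of_finiteDimensional
  have h1 := (NormedSpace.exp_series_hasSum_exp' (𝕂 := ℝ) M).map Ψ hΨ
  have h2 := (NormedSpace.exp_series_hasSum_exp' (𝕂 := ℝ) c).mul_right (bC.repr z i)
  have hfun : (Ψ ∘ fun n : ℕ => ((n.factorial : ℝ)⁻¹ • M ^ n)) =
      fun n : ℕ => ((n.factorial : ℝ)⁻¹ • c ^ n) * bC.repr z i := by
    ext n
    rw [Function.comp_apply, map_smul]
    change (n.factorial : ℝ)⁻¹ • bC.repr ((Matrix.toLin b b (M ^ n)).baseChange ℂ z) i = _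
    rw [hpow, map_smul, Finsupp.smul_apply, smul_eq_mul, smul_mul_assoc]
  rw [hfun] at h1
  have := h1.unique h2
  rw [map_smul, Finsupp.smul_apply, smul_eq_mul, Complex.exp_eq_exp_ℂ, ← this]
  rfl

theorem endExp_apply_of_apply_eq_zero {A : V →ₗ[ℝ] V} {x : V} (h : A x = 0) : endExp A x = x := by
  have h1 : A.baseChange ℂ ((1 : ℂ) ⊗ₜ[ℝ] x) = (0 : ℂ) • ((1 : ℂ) ⊗ₜ[ℝ] x) := by simp [h]
  have h2 := endExp_baseChange_apply h1
  rw [Complex.exp_zero, one_smul, LinearMap.baseChange_tmul] at h2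
  simpa using congrArg ((TensorProduct.lid ℝ V).toLinearMap ∘ₗ LinearMap.rTensor V Complex.reLm) h2

end Exponential

section Derivation

attribute [local instance] Matrix.linftyOpNormedRing Matrix.linftyOpNormedAlgebra

variable {g₀ : Type*} [LieRing g₀] [LieAlgebra ℝ g₀] [FiniteDimensional ℝ g₀]

/-- The exponential of a derivation is a homomorphism: writing `Υ_t = exp (t J)`, the derivative of
`t ↦ Υ_t⁻¹ ∘ ad (Υ_t x) ∘ Υ_t` vanishes. -/
theorem endExp_lie (J : LieDerivation ℝ g₀ g₀) (x y : g₀) :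
    endExp J.toLinearMap ⁅x, y⁆ = ⁅endExp J.toLinearMap x, endExp J.toLinearMap y⁆ := by
  let b := Module.finBasis ℝ g₀
  let n := Fin (Module.finrank ℝ g₀)
  let M : Matrix n n ℝ := LinearMap.toMatrix b b J.toLinearMap
  let B : g₀ →ₗ[ℝ] g₀ →ₗ[ℝ] g₀ := LinearMap.mk₂ ℝ (fun x y => ⁅x, y⁆) add_lie smul_lie lie_add
    fun c x y => lie_smul c x y
  let Θ : Matrix n n ℝ →ₗ[ℝ] Matrix n n ℝ :=
    { toFun := fun N => LinearMap.toMatrix b b (B (Matrix.toLin b b N x))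
      map_add' := fun N N' => by simp
      map_smul' := fun r N => by simp }
  have hΘ : ∀ N, Θ (M * N) = M * Θ N - Θ N * M := by
    intro N
    change LinearMap.toMatrix b b (B (Matrix.toLin b b (M * N) x)) =
      M * LinearMap.toMatrix b b (B (Matrix.toLin b b N x)) -
        LinearMap.toMatrix b b (B (Matrix.toLin b b N x)) * M
    rw [← LinearMap.toMatrix_comp b b b, ← LinearMap.toMatrix_comp b b b, ← map_sub,
      Matrix.toLin_mul b b b, Matrix.toLin_toMatrix]
    congr 1
    ext w
    change ⁅J (Matrix.toLin b b N x), w⁆ =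
      J ⁅Matrix.toLin b b N x, w⁆ - ⁅Matrix.toLin b b N x, J w⁆
    rw [LieDerivation.apply_lie_eq_add]
    abel
  let Θ' := LinearMap.toContinuousLinearMap Θ
  let F : ℝ → Matrix n n ℝ := fun t =>
    NormedSpace.exp (t • (-M)) * Θ (NormedSpace.exp (t • M)) * NormedSpace.exp (t • M)
  have hF : ∀ t, HasDerivAt F 0 t := by
    intro t
    have h1 := hasDerivAt_exp_smul_const (𝕂 := ℝ) (-M) t
    have h2 := hasDerivAt_exp_smul_const' (𝕂 := ℝ) M t
    have h3 : HasDerivAt (fun t : ℝ => Θ (NormedSpace.exp (t • M)))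
        (Θ (M * NormedSpace.exp (t • M))) t := Θ'.hasFDerivAt.comp_hasDerivAt t h2
    refine ((h1.mul h3).mul h2).congr_deriv ?_
    have hring : ∀ E A N : Matrix n n ℝ,
        (E * -M * A + E * (M * A - A * M)) * N + E * A * (M * N) = 0 := fun E A N => by
      rw [mul_sub, mul_neg, neg_mul, ← mul_assoc, ← mul_assoc, ← mul_assoc]
      simp only [add_mul, sub_mul, neg_mul]
      abel
    rw [hΘ]
    exact hring _ _ _
  have hconst : F 1 = F 0 :=
    is_const_of_deriv_eq_zero (fun t => (hF t).differentiableAt) (fun t => (hF t).deriv) 1 0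
  simp only [F, one_smul, zero_smul, NormedSpace.exp_zero, one_mul, mul_one] at hconst
  have hinv : NormedSpace.exp M * NormedSpace.exp (-M) = 1 := by
    rw [← Matrix.exp_add_of_commute _ _ (Commute.neg_right (Commute.refl M)), add_neg_cancel,
      NormedSpace.exp_zero]
  have hfin : Θ (NormedSpace.exp M) * NormedSpace.exp M = NormedSpace.exp M * Θ 1 := by
    rw [← hconst, ← mul_assoc, ← mul_assoc, hinv, one_mul]
  have hlin := congrArg (Matrix.toLin b b) hfin
  rw [Matrix.toLin_mul b b b, Matrix.toLin_mul b b b] at hlin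
  have := LinearMap.congr_fun hlin y
  have hΘN : ∀ N : Matrix n n ℝ, Matrix.toLin b b (Θ N) = B (Matrix.toLin b b N x) := fun N =>
    Matrix.toLin_toMatrix b b _
  rw [LinearMap.comp_apply, LinearMap.comp_apply, hΘN, hΘN, Matrix.toLin_one] at this
  exact this.symm

end Derivation

/-! ### The subalgebra `q` and the combinations of elements of `Q` -/

section Flag

open LieAlgebra LieModule

variable {u₀ : Type*} [LieRing u₀] [LieAlgebra ℝ u₀]
  {t₀ : LieSubalgebra ℝ u₀} [IsLieAbelian t₀] {Q : Set (Module.Dual ℂ (complexify t₀))}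

theorem IsFlagSet.isRoot (hQ : IsFlagSet t₀ Q) :
    ∀ β ∈ Q, β ≠ 0 ∧ rootSpace (complexify t₀) β ≠ ⊥ := fun _ hβ => hQ.subset_roots hβ

theorem IsFlagSet.mem_closure (hQ : IsFlagSet t₀ Q) (α : Module.Dual ℂ (complexify t₀))
    (hα : α ≠ 0) (hαr : rootSpace (complexify t₀) α ≠ ⊥) : α ∈ AddSubgroup.closure Q :=
  hQ.roots_subset ⟨hα, hαr⟩

theorem IsFlagSet.mem_closure_of_weight (hQ : IsFlagSet t₀ Q) (α : Module.Dual ℂ (complexify t₀))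
    (hαr : rootSpace (complexify t₀) α ≠ ⊥) : α ∈ AddSubgroup.closure Q := by
  by_cases hα : α = 0
  · rw [hα]
    exact zero_mem _
  · exact hQ.mem_closure α hα hαr

theorem mem_qStar_iff {h : ℤ} {α : Module.Dual ℂ (complexify t₀)} :
    α ∈ qStar t₀ Q h ↔ α ∈ roots t₀ ∧ (α, h) ∈ AddSubgroup.closure (heightGraph Q) := by
  rw [mem_closure_heightGraph]
  rfl

theorem mem_flagSubspace_of_mem_complexify {z : ℂ ⊗[ℝ] u₀} (hz : z ∈ complexify t₀) :
    z ∈ flagSubspace t₀ Q :=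
  (le_sup_left : (complexify t₀).toSubmodule ≤ flagSubspace t₀ Q) hz

theorem mem_flagSubspace_of_mem_rootSpace {β : Module.Dual ℂ (complexify t₀)} (hβ : β ∈ Q)
    {z : ℂ ⊗[ℝ] u₀} (hz : z ∈ rootSpace (complexify t₀) β) : z ∈ flagSubspace t₀ Q :=
  (le_sup_right : _ ≤ flagSubspace t₀ Q)
    (Submodule.mem_iSup_of_mem β (Submodule.mem_iSup_of_mem hβ hz))

theorem flagSubspace_induction {p : ℂ ⊗[ℝ] u₀ → Prop} (hH : ∀ z ∈ complexify t₀, p z)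
    (hQ : ∀ β ∈ Q, ∀ z ∈ rootSpace (complexify t₀) β, p z)
    (hadd : ∀ z w, p z → p w → p (z + w)) {z : ℂ ⊗[ℝ] u₀} (hz : z ∈ flagSubspace t₀ Q) : p z := by
  obtain ⟨x, hx, y, hy, rfl⟩ := Submodule.mem_sup.mp hz
  refine hadd _ _ (hH x hx) ?_
  rw [iSup_subtype'] at hy
  refine Submodule.iSup_induction _ (motive := p) hy (fun β z hz => hQ β β.2 z hz)
    (hH 0 (zero_mem _)) hadd

theorem mem_closure_heightGraph_of_mem_qStarOneOne {γ : Module.Dual ℂ (complexify t₀)}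
    (hγ : γ ∈ qStarOneOne t₀ Q) : (γ, (0 : ℤ)) ∈ AddSubgroup.closure (heightGraph Q) := by
  obtain ⟨-, β₁, h₁, β₂, h₂, h⟩ := hγ
  have h₁' : (β₁, (1 : ℤ)) ∈ AddSubgroup.closure (heightGraph Q) :=
    AddSubgroup.subset_closure ⟨β₁, h₁, rfl⟩
  have h₂' : (β₂, (1 : ℤ)) ∈ AddSubgroup.closure (heightGraph Q) :=
    AddSubgroup.subset_closure ⟨β₂, h₂, rfl⟩
  rcases h with rfl | rfl
  · simpa using sub_mem h₁' h₂'
  · simpa using neg_mem (sub_mem h₁' h₂')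

/-- A relation `∑ kᵢ βᵢ = 0` shifts the height of every element of `Q*_{1,1}` by `∑ kᵢ`. If there is
no such element, then `Q` is strongly orthogonal and there is no nontrivial relation. -/
theorem dvd_height_of_inter_eq_empty [FiniteDimensional ℝ u₀] [IsKilling ℂ (ℂ ⊗[ℝ] u₀)]
    [(complexify t₀).IsCartanSubalgebra] (hQ : IsFlagSet t₀ Q) {m : ℤ}
    (h : ∀ s : ℤ, ¬ m ∣ s → qStarOneOne t₀ Q ∩ qStar t₀ Q s = ∅) {s : ℤ}
    (hs : ((0 : Module.Dual ℂ (complexify t₀)), s) ∈ AddSubgroup.closure (heightGraph Q)) :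
    m ∣ s := by
  by_cases hne : (qStarOneOne t₀ Q).Nonempty
  · obtain ⟨γ, hγ⟩ := hne
    by_contra hm
    have hmem : γ ∈ qStarOneOne t₀ Q ∩ qStar t₀ Q s := by
      refine ⟨hγ, mem_qStar_iff.mpr ⟨hγ.1, ?_⟩⟩
      simpa using add_mem (mem_closure_heightGraph_of_mem_qStarOneOne hγ) hs
    rw [h s hm] at hmem
    exact hmem
  · rw [Set.not_nonempty_iff_eq_empty, Set.eq_empty_iff_forall_notMem] at hne
    have hs0 := height_eq_zero_of_stronglyOrthogonal hQ.isRoot (fun α hα β hβ hαβ => ?_)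
      (fun α hα β hβ hαβ => ?_) hs
    · rw [hs0]
      exact dvd_zero m
    · by_contra hr
      refine hQ.add_notMem β hβ α hα ⟨fun h0 => hQ.neg_notMem α hα ?_, hr⟩
      rwa [← eq_neg_of_add_eq_zero_left h0]
    · by_contra hr
      exact hne (β - α) ⟨⟨sub_ne_zero.mpr hαβ.symm, hr⟩, β, hβ, α, hα, Or.inl rfl⟩

/-- The height lifts to an integer valued function which is additive on weights, normalised to be
`-1` modulo `m` on `Q`; the sign matches the eigenvalue `-i` demanded by `X + i J X ∈ q`. -/
theorem exists_height [FiniteDimensional ℝ u₀] [IsKilling ℂ (ℂ ⊗[ℝ] u₀)]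
    [(complexify t₀).IsCartanSubalgebra] (hQ : IsFlagSet t₀ Q) {m : ℤ}
    (hm : ∀ s : ℤ, ((0 : Module.Dual ℂ (complexify t₀)), s) ∈ AddSubgroup.closure (heightGraph Q) →
      m ∣ s) :
    ∃ n : Module.Dual ℂ (complexify t₀) → ℤ,
      (∀ α β : Module.Dual ℂ (complexify t₀), rootSpace (complexify t₀) α ≠ ⊥ →
        rootSpace (complexify t₀) β ≠ ⊥ → n (α + β) = n α + n β) ∧
      n 0 = 0 ∧
      (∀ α : Module.Dual ℂ (complexify t₀), rootSpace (complexify t₀) α ≠ ⊥ → n (-α) = -n α) ∧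
      ∀ β ∈ Q, m ∣ n β + 1 := by
  have hfin : Q.Finite :=
    (finite_weights (H := complexify t₀)).subset fun β hβ => (hQ.isRoot β hβ).2
  have : IsAddTorsionFree (Module.Dual ℂ (complexify t₀)) := .of_isTorsionFree ℂ _
  obtain ⟨n, hadd, hn⟩ := exists_additive_of_dvd_height hfin hm
  have h0 : n 0 = 0 := by simpa using hadd 0 (zero_mem _) 0 (zero_mem _)
  refine ⟨n, fun α β hα hβ =>
    hadd α (hQ.mem_closure_of_weight α hα) β (hQ.mem_closure_of_weight β hβ), h0,
    fun α hα => ?_, hn⟩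
  have hα' := hQ.mem_closure_of_weight α hα
  have := hadd α hα' (-α) (neg_mem hα')
  rw [add_neg_cancel, h0] at this
  omega

end Flag

section CompactFlag

open LieAlgebra LieModule

variable {u₀ : Type*} [LieRing u₀] [LieAlgebra ℝ u₀] [FiniteDimensional ℝ u₀]
  {t₀ : LieSubalgebra ℝ u₀} [IsLieAbelian t₀] {Q : Set (Module.Dual ℂ (complexify t₀))}
  [IsKilling ℂ (ℂ ⊗[ℝ] u₀)] [(complexify t₀).IsCartanSubalgebra]

/-- A diagonal endomorphism is defined over `ℝ` if its eigenvalues on the root spaces of `α` and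
`-α` are conjugate. -/
theorem diagonal_conj
    (hconj : ∀ α : Module.Dual ℂ (complexify t₀), ∀ z ∈ rootSpace (complexify t₀) α,
      conj z ∈ rootSpace (complexify t₀) (-α : Module.Dual ℂ (complexify t₀)))
    {f : Module.Dual ℂ (complexify t₀) → ℂ} {T : (ℂ ⊗[ℝ] u₀) →ₗ[ℂ] (ℂ ⊗[ℝ] u₀)}
    (hT : ∀ α : Module.Dual ℂ (complexify t₀), ∀ z ∈ rootSpace (complexify t₀) α, T z = f α • z)
    (hf : ∀ α : Module.Dual ℂ (complexify t₀), rootSpace (complexify t₀) α ≠ ⊥ →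
      f (-α) = starRingEnd ℂ (f α)) (z : ℂ ⊗[ℝ] u₀) : T (conj z) = conj (T z) := by
  let S : (ℂ ⊗[ℝ] u₀) →ₗ[ℂ] (ℂ ⊗[ℝ] u₀) :=
    { toFun := fun z => conj (T (conj z))
      map_add' := fun z w => by rw [map_add, map_add, map_add]
      map_smul' := fun c z => by rw [conj_smul, map_smul, conj_smul, Complex.conj_conj]; rfl }
  have hST : S = T := by
    refine linearMap_ext_rootSpace (H := complexify t₀) fun α z hz => ?_
    by_cases hα : rootSpace (complexify t₀) α = ⊥
    · rw [hα, LieSubmodule.mem_bot] at hz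
      simp [hz]
    change conj (T (conj z)) = T z
    rw [hT _ _ (hconj α z hz), hT α z hz, conj_smul, conj_conj, hf α hα, Complex.conj_conj]
  have h : conj (T (conj (conj z))) = T (conj z) := LinearMap.congr_fun hST (conj z)
  rw [conj_conj] at h
  exact h.symm

/-- `q ∩ conj q` is the complexified torus. -/
theorem mem_complexify_of_mem_flagSubspace
    (hconj : ∀ α : Module.Dual ℂ (complexify t₀), ∀ z ∈ rootSpace (complexify t₀) α,
      conj z ∈ rootSpace (complexify t₀) (-α : Module.Dual ℂ (complexify t₀)))
    (hQ : IsFlagSet t₀ Q) {z : ℂ ⊗[ℝ] u₀} (hz : z ∈ flagSubspace t₀ Q)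
    (hz' : conj z ∈ flagSubspace t₀ Q) : z ∈ complexify t₀ := by
  classical
  -- `T` is the projection onto the sum of the root spaces of `Q`.
  obtain ⟨T, hT⟩ := exists_diagonal (H := complexify t₀) (fun α => if α ∈ Q then (1 : ℂ) else 0)
  have h0 : (0 : Module.Dual ℂ (complexify t₀)) ∉ Q := fun h => (hQ.isRoot 0 h).1 rfl
  have hTH : ∀ z ∈ complexify t₀, T z = 0 := fun z hz => by
    rw [hT 0 z (mem_rootSpace_zero.mpr hz), if_neg h0, zero_smul]
  have h1 : z - T z ∈ complexify t₀ := by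
    refine flagSubspace_induction (p := fun z => z - T z ∈ complexify t₀) (fun z hz => ?_)
      (fun β hβ z hz => ?_) (fun z w hz hw => ?_) hz
    · rwa [hTH z hz, sub_zero]
    · rw [hT β z hz, if_pos hβ, one_smul, sub_self]
      exact zero_mem _
    · rw [map_add, add_sub_add_comm]
      exact add_mem hz hw
  have h2 : T (conj (conj z)) = 0 := by
    refine flagSubspace_induction (p := fun z => T (conj z) = 0) (fun z hz => ?_)
      (fun β hβ z hz => ?_) (fun z w hz hw => ?_) hz'
    · exact hTH _ (conj_mem_complexify hz)
    · rw [hT _ _ (hconj β z hz), if_neg (hQ.neg_notMem β hβ), zero_smul]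
    · rw [map_add, map_add, hz, hw, add_zero]
  rw [conj_conj] at h2
  rwa [h2, sub_zero] at h1

theorem mem_isotropy_iff
    (hconj : ∀ α : Module.Dual ℂ (complexify t₀), ∀ z ∈ rootSpace (complexify t₀) α,
      conj z ∈ rootSpace (complexify t₀) (-α : Module.Dual ℂ (complexify t₀)))
    (hQ : IsFlagSet t₀ Q) {x : u₀} : x ∈ isotropy (flagSubalgebra t₀ hQ) ↔ x ∈ t₀ := by
  have h : x ∈ isotropy (flagSubalgebra t₀ hQ) ↔ cplx x 0 ∈ flagSubspace t₀ Q := by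
    rw [← one_tmul_eq_cplx]
    rfl
  rw [h]
  constructor
  · intro hx
    have := mem_complexify_of_mem_flagSubspace hconj hQ hx (by simpa using hx)
    exact (cplx_mem_complexify.mp this).1
  · intro hx
    exact mem_flagSubspace_of_mem_complexify (cplx_mem_complexify.mpr ⟨hx, zero_mem _⟩)

/-- For a real endomorphism `T`, the condition `X + i T X ∈ q` for all `X = Re Z`, `Z ∈ q`, says
that the complexification of `T` agrees on `q` with multiplication by `-i` modulo `𝔥`. -/
theorem cplx_realParts_iff
    (hconj : ∀ α : Module.Dual ℂ (complexify t₀), ∀ z ∈ rootSpace (complexify t₀) α,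
      conj z ∈ rootSpace (complexify t₀) (-α : Module.Dual ℂ (complexify t₀)))
    (hQ : IsFlagSet t₀ Q) (T : u₀ →ₗ[ℝ] u₀) :
    (∀ x ∈ realParts (flagSubalgebra t₀ hQ), cplx x (T x) ∈ flagSubalgebra t₀ hQ) ↔
      ∀ z ∈ flagSubspace t₀ Q, T.baseChange ℂ z + Complex.I • z ∈ complexify t₀ := by
  have hreal : ∀ x : u₀, cplx x 0 ∈ flagSubspace t₀ Q → x ∈ t₀ := fun x hx =>
    (mem_isotropy_iff hconj hQ).mp (by rwa [← one_tmul_eq_cplx] at hx)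
  constructor
  · intro h
    have key : ∀ x y, cplx x y ∈ flagSubspace t₀ Q → T x - y ∈ t₀ := by
      intro x y hxy
      have h1 : cplx x (T x) ∈ flagSubspace t₀ Q := h x ⟨y, hxy⟩
      have h2 := (flagSubspace t₀ Q).smul_mem (-Complex.I) (sub_mem h1 hxy)
      apply hreal
      convert h2 using 1
      rw [cplx_sub, smul_cplx]
      simp
    intro z hz
    obtain ⟨x, y, rfl⟩ := exists_eq_cplx z
    have hIz := (flagSubspace t₀ Q).smul_mem Complex.I hz
    rw [I_smul_cplx] at hIz
    have h1 := key _ _ hz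
    have h2 := neg_mem (key _ _ hIz)
    rw [baseChange_cplx, I_smul_cplx, cplx_add, cplx_mem_complexify]
    refine ⟨by rwa [← sub_eq_add_neg], ?_⟩
    rw [map_neg, neg_sub, sub_neg_eq_add] at h2
    rwa [add_comm]
  · rintro h x ⟨y, hxy⟩
    have h1 := h _ hxy
    rw [baseChange_cplx, I_smul_cplx, cplx_add, cplx_mem_complexify] at h1
    have h2 : cplx 0 (T x + -y) ∈ flagSubspace t₀ Q :=
      mem_flagSubspace_of_mem_complexify (cplx_mem_complexify.mpr ⟨zero_mem _, h1.1⟩)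
    have h3 : cplx x y ∈ flagSubspace t₀ Q := hxy
    have h4 := add_mem h3 h2
    rw [cplx_add] at h4
    change cplx x (T x) ∈ flagSubspace t₀ Q
    simpa using h4

/-- The `CR` algebra `(𝔲₀, q)` is fundamental, so that the condition `ker (Id - λ) ⊆ q♮` on a
`CR`-symmetry is automatic. -/
theorem qNatural_eq_top
    (hconj : ∀ α : Module.Dual ℂ (complexify t₀), ∀ z ∈ rootSpace (complexify t₀) α,
      conj z ∈ rootSpace (complexify t₀) (-α : Module.Dual ℂ (complexify t₀)))
    (hQ : IsFlagSet t₀ Q) : qNatural (flagSubalgebra t₀ hQ) = ⊤ := by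
  have hsub := LieSubalgebra.subset_lieSpan (R := ℂ)
    (s := (flagSubalgebra t₀ hQ : Set (ℂ ⊗[ℝ] u₀)) ∪
      conj '' (flagSubalgebra t₀ hQ : Set (ℂ ⊗[ℝ] u₀)))
  refine lieSubalgebra_eq_top (H := complexify t₀) hQ.isRoot hQ.mem_closure (fun z hz => ?_)
    (fun β hβ z hz => ?_) (fun β hβ z hz => ?_)
  · exact hsub (Or.inl (mem_flagSubspace_of_mem_complexify hz))
  · exact hsub (Or.inl (mem_flagSubspace_of_mem_rootSpace hβ hz))
  · refine hsub (Or.inr ⟨conj z, ?_, conj_conj z⟩)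
    have := hconj _ z hz
    rw [neg_neg] at this
    exact mem_flagSubspace_of_mem_rootSpace hβ this

/-- The obstruction carried by an automorphism acting on `q / 𝔥` as the scalar `c`: it acts on the
root space of `γ` both as `c ^ 0`, since `Q*_{1,1} ⊆ Q*_0`, and as `c ^ s`. -/
theorem zpow_eq_one_of_mem_inter (hQ : IsFlagSet t₀ Q)
    {φ : (ℂ ⊗[ℝ] u₀) →ₗ⁅ℂ⁆ (ℂ ⊗[ℝ] u₀)} (hφ : ∀ z ∈ complexify t₀, φ z ∈ complexify t₀)
    {c : ℂ} (hc : c ≠ 0) (hφQ : ∀ z ∈ flagSubspace t₀ Q, φ z - c • z ∈ complexify t₀)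
    {γ : Module.Dual ℂ (complexify t₀)} {s : ℤ} (hγ : γ ∈ qStarOneOne t₀ Q)
    (hγs : γ ∈ qStar t₀ Q s) : c ^ s = 1 := by
  obtain ⟨z, hz, hz0⟩ := (⟨γ, hγ.1.2⟩ : Weight ℂ (complexify t₀) (ℂ ⊗[ℝ] u₀)).exists_ne_zero
  have key : ∀ k : ℤ, (γ, k) ∈ AddSubgroup.closure (heightGraph Q) → φ z = c ^ k • z := fun k hk =>
    lieHom_apply_of_mem_rootSpace hQ.isRoot hQ.mem_closure hφ hc
      (fun β hβ z hz => hφQ z (mem_flagSubspace_of_mem_rootSpace hβ hz)) hγ.1.2 hk z hz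
  have h1 := key 0 (mem_closure_heightGraph_of_mem_qStarOneOne hγ)
  rw [key s (mem_qStar_iff.mp hγs).2, zpow_zero, ← sub_eq_zero, ← sub_smul,
    smul_eq_zero_iff_left hz0, sub_eq_zero] at h1
  exact h1

end CompactFlag

/-! ### The criteria -/

section Criteria

open LieAlgebra LieModule

variable {u₀ : Type*} [LieRing u₀] [LieAlgebra ℝ u₀] [FiniteDimensional ℝ u₀]
  {t₀ : LieSubalgebra ℝ u₀} [IsLieAbelian t₀] {Q : Set (Module.Dual ℂ (complexify t₀))}
  [IsKilling ℂ (ℂ ⊗[ℝ] u₀)] [(complexify t₀).IsCartanSubalgebra]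

/-- The real derivation acting on the root space of `α` as `i n(α)`, for an additive integer valued
function `n` on the roots. -/
theorem exists_derivation
    (hconj : ∀ α : Module.Dual ℂ (complexify t₀), ∀ z ∈ rootSpace (complexify t₀) α,
      conj z ∈ rootSpace (complexify t₀) (-α : Module.Dual ℂ (complexify t₀)))
    {n : Module.Dual ℂ (complexify t₀) → ℤ}
    (hadd : ∀ α β : Module.Dual ℂ (complexify t₀), rootSpace (complexify t₀) α ≠ ⊥ →
      rootSpace (complexify t₀) β ≠ ⊥ → n (α + β) = n α + n β)
    (hneg : ∀ α : Module.Dual ℂ (complexify t₀), rootSpace (complexify t₀) α ≠ ⊥ →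
      n (-α) = -n α) :
    ∃ J : LieDerivation ℝ u₀ u₀, ∀ α : Module.Dual ℂ (complexify t₀),
      ∀ z ∈ rootSpace (complexify t₀) α,
        J.toLinearMap.baseChange ℂ z = (Complex.I * n α) • z := by
  obtain ⟨T, hT⟩ := exists_diagonal (H := complexify t₀) (fun α => Complex.I * n α)
  obtain ⟨S, rfl⟩ := exists_baseChange_eq (diagonal_conj hconj hT (fun α hα => by
    simp [hneg α hα]))
  have hlie := diagonal_lie_eq_of_add hT (fun α β hα hβ => by
    rw [hadd α β hα hβ]; push_cast; ring)
  refine ⟨⟨S, fun a b => ?_⟩, hT⟩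
  have h := hlie (cplx a 0) (cplx b 0)
  simp only [lie_cplx, baseChange_cplx, cplx_add, cplx_inj] at h
  have h1 := h.1
  simp only [map_zero, lie_zero, sub_zero] at h1
  rw [h1, ← lie_skew (S a) b, ← sub_eq_add_neg]

/-- A `CR`-symmetry acts on `q` as `-1` modulo `𝔥`; conversely, `(-1) ^ n(α)` on the root spaces is
one when `n` is odd on `Q`. -/
theorem isCRSymmetric_iff (hu₀ : ∀ x : u₀, x ≠ 0 → killingForm ℝ u₀ x x < 0)
    (hconj : ∀ α : Module.Dual ℂ (complexify t₀), ∀ z ∈ rootSpace (complexify t₀) α,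
      conj z ∈ rootSpace (complexify t₀) (-α : Module.Dual ℂ (complexify t₀)))
    (hQ : IsFlagSet t₀ Q) : IsCRSymmetric (flagSubalgebra t₀ hQ) ↔
      ∀ h : ℤ, qStarOneOne t₀ Q ∩ qStar t₀ Q (2 * h + 1) = ∅ := by
  constructor
  · rintro ⟨-, lam, -, hreal, -, hlamq, hZ⟩ h
    rw [Set.eq_empty_iff_forall_notMem]
    rintro γ ⟨hγ, hγh⟩
    have hlam1 : ∀ x : u₀, ∃ y : u₀, lam (cplx x 0) = cplx y 0 := by
      intro x
      obtain ⟨y, hy⟩ := hreal.le ⟨_, ⟨x, rfl⟩, rfl⟩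
      exact ⟨y, by rw [← one_tmul_eq_cplx, ← one_tmul_eq_cplx]; exact hy.symm⟩
    have hcomm : ∀ z, lam (conj z) = conj (lam z) := by
      intro z
      obtain ⟨x, y, rfl⟩ := exists_eq_cplx z
      obtain ⟨x', hx'⟩ := hlam1 x
      obtain ⟨y', hy'⟩ := hlam1 y
      have e : ∀ a b : u₀, cplx a b = cplx a 0 + Complex.I • cplx b 0 := fun a b => by
        rw [I_smul_cplx, cplx_add]; simp
      have e' : ∀ a b : u₀, cplx a (-b) = cplx a 0 - Complex.I • cplx b 0 := fun a b => by
        rw [I_smul_cplx, cplx_sub]; simp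
      have hl : lam (cplx x y) = cplx x' y' := by rw [e x y, map_add, map_smul, hx', hy', ← e]
      have hl' : lam (cplx x (-y)) = cplx x' (-y') := by
        rw [e' x y, map_sub, map_smul, hx', hy', ← e']
      rw [conj_cplx, hl', hl, conj_cplx]
    have hq : ∀ z ∈ flagSubspace t₀ Q, lam z ∈ flagSubspace t₀ Q := fun z hz =>
      hlamq.le ⟨z, hz, rfl⟩
    have hH : ∀ z ∈ complexify t₀, lam z ∈ complexify t₀ := fun z hz =>
      mem_complexify_of_mem_flagSubspace hconj hQ (hq z (mem_flagSubspace_of_mem_complexify hz))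
        (by
          rw [← hcomm]
          exact hq _ (mem_flagSubspace_of_mem_complexify (conj_mem_complexify hz)))
    have h1 := zpow_eq_one_of_mem_inter hQ hH (c := -1) (by simp) (fun z hz => by
      rw [neg_smul, one_smul, sub_neg_eq_add, add_comm]
      exact mem_complexify_of_mem_flagSubspace hconj hQ (hZ z hz).1 (hZ z hz).2) hγ hγh
    rw [Odd.neg_one_zpow ⟨h, rfl⟩] at h1
    norm_num at h1
  · intro h
    obtain ⟨n, hadd, hn0, hneg, hn⟩ := exists_height hQ (m := 2) fun s hs =>
      dvd_height_of_inter_eq_empty hQ (fun s hs => by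
        obtain ⟨k, rfl⟩ := Int.not_even_iff_odd.mp fun he => hs he.two_dvd
        exact h k) hs
    obtain ⟨T, hT⟩ := exists_diagonal (H := complexify t₀) (fun α => (-1 : ℂ) ^ n α)
    have hTc := diagonal_conj hconj hT (fun α hα => by
      rw [hneg α hα, zpow_neg, ← inv_zpow, inv_neg, inv_one]
      simp)
    have hlie := diagonal_lie_eq_of_mul hT (fun α β hα hβ => by
      rw [hadd α β hα hβ, zpow_add₀ (by norm_num)])
    have hTT : ∀ z, T (T z) = z := by
      suffices T ∘ₗ T = LinearMap.id from LinearMap.congr_fun this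
      refine linearMap_ext_rootSpace (H := complexify t₀) fun α z hz => ?_
      rw [LinearMap.comp_apply, hT α z hz, map_smul, hT α z hz, smul_smul, ← mul_zpow]
      simp
    have hTH : ∀ z ∈ complexify t₀, T z = z := fun z hz => by
      rw [hT 0 z (mem_rootSpace_zero.mpr hz), hn0, zpow_zero, one_smul]
    have hTQ : ∀ β ∈ Q, ∀ z ∈ rootSpace (complexify t₀) β, T z = -z := fun β hβ z hz => by
      have hodd : Odd (n β) := by
        obtain ⟨k, hk⟩ := hn β hβ
        exact ⟨k - 1, by omega⟩
      rw [hT β z hz, hodd.neg_one_zpow, neg_smul, one_smul]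
    have hTq : ∀ z ∈ flagSubspace t₀ Q, T z ∈ flagSubspace t₀ Q := fun z hz => by
      refine flagSubspace_induction (p := fun z => T z ∈ flagSubspace t₀ Q) (fun z hz => ?_)
        (fun β hβ z hz => ?_) (fun z w hz hw => ?_) hz
      · rw [hTH z hz]
        exact mem_flagSubspace_of_mem_complexify hz
      · rw [hTQ β hβ z hz]
        exact neg_mem (mem_flagSubspace_of_mem_rootSpace hβ hz)
      · rw [map_add]
        exact add_mem hz hw
    have hTsum : ∀ z ∈ flagSubspace t₀ Q, z + T z ∈ complexify t₀ := fun z hz => by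
      refine flagSubspace_induction (p := fun z => z + T z ∈ complexify t₀) (fun z hz => ?_)
        (fun β hβ z hz => ?_) (fun z w hz hw => ?_) hz
      · rw [hTH z hz]
        exact add_mem hz hz
      · rw [hTQ β hβ z hz, add_neg_cancel]
        exact zero_mem _
      · rw [map_add, add_add_add_comm]
        exact add_mem hz hw
    -- A conjugation-invariant endomorphism preserves the real form.
    have hTreal : ∀ x : u₀, ∃ y : u₀, (1 : ℂ) ⊗ₜ[ℝ] y = T ((1 : ℂ) ⊗ₜ[ℝ] x) := fun x => by
      rw [← conj_eq_self_iff, ← hTc, conj_eq_self_iff.mpr ⟨x, rfl⟩]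
    refine ⟨⟨isotropy (flagSubalgebra t₀ hQ), ⊥, fun x _ hx => hu₀ x hx, bot_le, disjoint_bot_right,
      sup_bot_eq _⟩, { T with map_lie' := fun {x y} => hlie x y }, hTT, ?_, fun z _ => ?_, ?_,
      fun z hz => ?_⟩
    · refine Set.Subset.antisymm ?_ ?_
      · rintro _ ⟨_, ⟨x, rfl⟩, rfl⟩
        exact hTreal x
      · rintro _ ⟨x, rfl⟩
        obtain ⟨y, hy⟩ := hTreal x
        refine ⟨_, ⟨y, rfl⟩, ?_⟩
        change T ((1 : ℂ) ⊗ₜ[ℝ] y) = _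
        rw [hy, hTT]
    · rw [qNatural_eq_top hconj hQ]
      exact LieSubalgebra.mem_top _
    · refine Set.Subset.antisymm ?_ ?_
      · rintro _ ⟨z, hz, rfl⟩
        exact hTq z hz
      · intro z hz
        exact ⟨T z, hTq z hz, hTT z⟩
    · have := hTsum z hz
      exact ⟨mem_flagSubspace_of_mem_complexify this,
        mem_flagSubspace_of_mem_complexify (conj_mem_complexify this)⟩

/-- The automorphism `exp (π J / 2)` acts on `q` as `-i` modulo `𝔥`; conversely, `J = i n(α)` on the
root spaces has this property when `n` is `-1` modulo `4` on `Q`. -/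
theorem hasWeakJProperty_iff
    (hconj : ∀ α : Module.Dual ℂ (complexify t₀), ∀ z ∈ rootSpace (complexify t₀) α,
      conj z ∈ rootSpace (complexify t₀) (-α : Module.Dual ℂ (complexify t₀)))
    (hQ : IsFlagSet t₀ Q) : HasWeakJProperty (flagSubalgebra t₀ hQ) ↔
      ∀ h : ℤ, qStarOneOne t₀ Q ∩ qStar t₀ Q (2 * h + 1) = ∅ ∧
        qStarOneOne t₀ Q ∩ qStar t₀ Q (4 * h + 2) = ∅ := by
  have hiso : ∀ x, x ∈ (isotropy (flagSubalgebra t₀ hQ) : Set u₀) ↔ x ∈ t₀ := fun x =>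
    mem_isotropy_iff hconj hQ
  have hI4 : Complex.I ^ (4 : ℤ) = 1 := by exact_mod_cast Complex.I_pow_four
  constructor
  · rintro ⟨J, hJ, hJr⟩
    let Υ := endExp ((π / 2) • J.toLinearMap)
    have hΥlie : ∀ x y, Υ ⁅x, y⁆ = ⁅Υ x, Υ y⁆ := endExp_lie ((π / 2) • J)
    let φ : (ℂ ⊗[ℝ] u₀) →ₗ⁅ℂ⁆ (ℂ ⊗[ℝ] u₀) :=
      { Υ.baseChange ℂ with
        map_lie' := fun {z w} => by
          change Υ.baseChange ℂ ⁅z, w⁆ = ⁅Υ.baseChange ℂ z, Υ.baseChange ℂ w⁆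
          obtain ⟨a, b, rfl⟩ := exists_eq_cplx z
          obtain ⟨x, y, rfl⟩ := exists_eq_cplx w
          simp only [lie_cplx, baseChange_cplx, map_sub, map_add, hΥlie] }
    have hφ : ∀ z, φ z = Υ.baseChange ℂ z := fun _ => rfl
    have hΥt : ∀ x ∈ t₀, Υ x ∈ t₀ := fun x hx =>
      (hiso _).mp (hJ.le ⟨x, (hiso x).mpr hx, rfl⟩)
    have hφH : ∀ z ∈ complexify t₀, φ z ∈ complexify t₀ := by
      intro z hz
      obtain ⟨x, y, rfl⟩ := exists_eq_cplx z
      rw [cplx_mem_complexify] at hz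
      rw [hφ, baseChange_cplx, cplx_mem_complexify]
      exact ⟨hΥt x hz.1, hΥt y hz.2⟩
    have hφq := (cplx_realParts_iff hconj hQ Υ).mp hJr
    have key : ∀ (γ : Module.Dual ℂ (complexify t₀)) (s : ℤ), γ ∈ qStarOneOne t₀ Q →
        γ ∈ qStar t₀ Q s → (-Complex.I) ^ s = 1 := fun γ s hγ hγs =>
      zpow_eq_one_of_mem_inter hQ hφH (neg_ne_zero.mpr Complex.I_ne_zero) (fun z hz => by
        rw [neg_smul, sub_neg_eq_add]
        exact hφq z hz) hγ hγs
    have hnI : (-Complex.I) ^ (2 : ℤ) = -1 := by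
      rw [zpow_ofNat, neg_sq, Complex.I_sq]
    intro h
    constructor
    · rw [Set.eq_empty_iff_forall_notMem]
      rintro γ ⟨hγ, hγh⟩
      have h1 := key γ _ hγ hγh
      -- The square of an odd power of `-i` is `-1`.
      have h2 : ((-Complex.I) ^ (2 * h + 1)) ^ (2 : ℤ) = -1 := by
        rw [← zpow_mul, mul_comm, zpow_mul, hnI, Odd.neg_one_zpow ⟨h, rfl⟩]
      rw [h1, one_zpow] at h2
      norm_num at h2
    · rw [Set.eq_empty_iff_forall_notMem]
      rintro γ ⟨hγ, hγh⟩
      have h1 := key γ _ hγ hγh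
      rw [show 4 * h + 2 = 2 * (2 * h + 1) by ring, zpow_mul, hnI,
        Odd.neg_one_zpow ⟨h, rfl⟩] at h1
      norm_num at h1
  · intro h
    obtain ⟨n, hadd, hn0, hneg, hn⟩ := exists_height hQ (m := 4) fun s hs =>
      dvd_height_of_inter_eq_empty hQ (fun s hs => by
        have : s % 4 = 2 ∨ s % 2 = 1 := by omega
        rcases this with h4 | h2
        · rw [show s = 4 * (s / 4) + 2 by omega]
          exact (h _).2
        · rw [show s = 2 * (s / 2) + 1 by omega]
          exact (h _).1) hs
    obtain ⟨J, hJ⟩ := exists_derivation hconj hadd hneg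
    have hJt : ∀ x ∈ t₀, J x = 0 := by
      intro x hx
      have := hJ 0 (cplx x 0) (mem_rootSpace_zero.mpr (cplx_mem_complexify.mpr ⟨hx, zero_mem _⟩))
      rw [hn0, Int.cast_zero, mul_zero, zero_smul, baseChange_cplx] at this
      simpa using congrArg rePart this
    have hΥt : ∀ x ∈ t₀, endExp ((π / 2) • J.toLinearMap) x = x := fun x hx =>
      endExp_apply_of_apply_eq_zero (by
        rw [LinearMap.smul_apply]
        exact (congrArg _ (hJt x hx)).trans (smul_zero _))
    refine ⟨J, ?_, (cplx_realParts_iff hconj hQ _).mpr fun z hz => ?_⟩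
    · ext x
      constructor
      · rintro ⟨y, hy, rfl⟩
        rwa [hΥt y ((hiso y).mp hy)]
      · exact fun hx => ⟨x, hx, hΥt x ((hiso x).mp hx)⟩
    · refine flagSubspace_induction (p := fun z =>
        (endExp ((π / 2) • J.toLinearMap)).baseChange ℂ z + Complex.I • z ∈ complexify t₀)
        (fun z hz => ?_) (fun β hβ z hz => ?_) (fun z w hz hw => ?_) hz
      · obtain ⟨x, y, rfl⟩ := exists_eq_cplx z
        have hz' := cplx_mem_complexify.mp hz
        rw [baseChange_cplx, hΥt x hz'.1, hΥt y hz'.2]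
        exact add_mem hz ((complexify t₀).smul_mem _ hz)
      · obtain ⟨k, hk⟩ := hn β hβ
        have hexp : Complex.exp ((π / 2 : ℝ) * (Complex.I * n β)) = -Complex.I := by
          rw [show ((π / 2 : ℝ) : ℂ) * (Complex.I * n β) = (n β : ℂ) * (π / 2 * Complex.I) by
            push_cast; ring, Complex.exp_int_mul, Complex.exp_pi_div_two_mul_I,
            show n β = 4 * k + -1 by omega, zpow_add₀ Complex.I_ne_zero, zpow_mul, hI4, one_zpow,
            one_mul, zpow_neg_one, Complex.inv_I]
        have hA : ((π / 2) • J.toLinearMap).baseChange ℂ z =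
            ((π / 2 : ℝ) * (Complex.I * n β) : ℂ) • z := by
          rw [LinearMap.baseChange_smul, LinearMap.smul_apply, hJ β z hz,
            mul_smul ((π / 2 : ℝ) : ℂ)]
          exact (algebraMap_smul ℂ (π / 2) _).symm
        rw [endExp_baseChange_apply hA, hexp, neg_smul, neg_add_cancel]
        exact zero_mem _
      · rw [map_add, smul_add, add_add_add_comm]
        exact add_mem hz hw

/-- The derivation is `ad W` with `W ∈ 𝔱₀` and `β(W) = -i` on `Q`, and the pieces are its
eigenspaces; conversely, a gradation excludes relations of nonzero height, so that `J = i n(α)` with `n = -1` on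
`Q` is defined. -/
theorem hasJProperty_iff (hu₀ : ∀ x : u₀, x ≠ 0 → killingForm ℝ u₀ x x < 0)
    (ht₀ : ∀ s : LieSubalgebra ℝ u₀, IsLieAbelian s → t₀ ≤ s → s = t₀)
    (hconj : ∀ α : Module.Dual ℂ (complexify t₀), ∀ z ∈ rootSpace (complexify t₀) α,
      conj z ∈ rootSpace (complexify t₀) (-α : Module.Dual ℂ (complexify t₀)))
    (hQ : IsFlagSet t₀ Q) : HasJProperty (flagSubalgebra t₀ hQ) ↔
      IsZGradation (gradedPiece t₀ Q) := by
  have hiso : ∀ x, x ∈ isotropy (flagSubalgebra t₀ hQ) ↔ x ∈ t₀ := fun x =>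
    mem_isotropy_iff hconj hQ
  constructor
  · rintro ⟨J, hJ, hJr⟩
    have := isKilling_of_neg hu₀
    obtain ⟨W, rfl⟩ := LieDerivation.IsKilling.exists_eq_ad J
    have hWt : W ∈ t₀ := mem_of_forall_lie_mem hu₀ ht₀ fun a ha => by
      rw [← lie_skew]
      have hWa : ⁅W, a⁆ ∈ isotropy (flagSubalgebra t₀ hQ) := by
        simpa using hJ a ((hiso a).mpr ha)
      exact neg_mem ((hiso _).mp hWa)
    let w : complexify t₀ := ⟨cplx W 0, cplx_mem_complexify.mpr ⟨hWt, zero_mem _⟩⟩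
    let A : Module.End ℂ (ℂ ⊗[ℝ] u₀) := LieModule.toEnd ℂ (complexify t₀) (ℂ ⊗[ℝ] u₀) w
    have hAlie : ∀ z, A z = ⁅cplx W 0, z⁆ := fun _ => rfl
    have hA : ∀ α : Module.Dual ℂ (complexify t₀), ∀ z ∈ rootSpace (complexify t₀) α,
        A z = α w • z := fun α z hz => IsKilling.lie_eq_smul_of_mem_rootSpace hz w
    have hq := (cplx_realParts_iff hconj hQ ((LieDerivation.ad ℝ u₀ W).toLinearMap)).mp hJr
    have hbase : ∀ z, (LieDerivation.ad ℝ u₀ W).toLinearMap.baseChange ℂ z = A z := by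
      intro z
      obtain ⟨x, y, rfl⟩ := exists_eq_cplx z
      rw [baseChange_cplx, hAlie, lie_cplx]
      simp
    have hβ : ∀ β ∈ Q, β w = -Complex.I := by
      intro β hβ
      obtain ⟨z, hz, hz0⟩ :=
        (⟨β, (hQ.isRoot β hβ).2⟩ : Weight ℂ (complexify t₀) (ℂ ⊗[ℝ] u₀)).exists_ne_zero
      have h1 := hq z (mem_flagSubspace_of_mem_rootSpace hβ hz)
      rw [hbase, hA β z hz, ← add_smul] at h1
      by_contra hne
      have hne' : β w + Complex.I ≠ 0 := fun h => hne (eq_neg_of_add_eq_zero_left h)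
      have hzH : z ∈ complexify t₀ := by
        have := (complexify t₀).smul_mem (β w + Complex.I)⁻¹ h1
        rwa [smul_smul, inv_mul_cancel₀ hne', one_smul] at this
      have hdis := (iSupIndep_genWeightSpace ℂ (complexify t₀) (ℂ ⊗[ℝ] u₀)).pairwiseDisjoint
        (fun h : (β : complexify t₀ → ℂ) = ((0 : Module.Dual ℂ (complexify t₀)) : _ → ℂ) =>
          (hQ.isRoot β hβ).1 (DFunLike.coe_injective h))
      have hinf : z ∈ rootSpace (complexify t₀) β ⊓
          rootSpace (complexify t₀) (0 : Module.Dual ℂ (complexify t₀)) :=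
        ⟨hz, mem_rootSpace_zero.mpr hzH⟩
      rw [hdis.eq_bot, LieSubmodule.mem_bot] at hinf
      exact hz0 hinf
    have hval : ∀ p ∈ AddSubgroup.closure (heightGraph Q), p.1 w = -Complex.I * p.2 := by
      intro p hp
      induction hp using AddSubgroup.closure_induction with
      | mem p hp =>
        obtain ⟨β, hβQ, rfl⟩ := hp
        simp [hβ β hβQ]
      | zero => simp
      | add p q _ _ hp hq =>
        rw [Prod.fst_add, LinearMap.add_apply, hp, hq, Prod.snd_add]
        push_cast
        ring
      | neg p _ hp =>
        rw [Prod.fst_neg, LinearMap.neg_apply, hp, Prod.snd_neg]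
        push_cast
        ring
    -- The pieces are the eigenspaces of `ad W`.
    have hle : gradedPiece t₀ Q ≤ fun h : ℤ => A.eigenspace (-Complex.I * h) := by
      intro h
      refine sup_le ?_ (iSup₂_le fun α hα z hz => ?_)
      · split_ifs with h0
        · intro z hz
          have hA0 := hA 0 z (mem_rootSpace_zero.mpr hz)
          rw [Module.End.mem_eigenspace_iff, hA0, h0]
          simp
        · exact bot_le
      · rw [Module.End.mem_eigenspace_iff, hA α z hz, hval _ (mem_qStar_iff.mp hα).2]
    have hind : iSupIndep fun h : ℤ => A.eigenspace (-Complex.I * h) :=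
      A.eigenspaces_iSupIndep.comp (f := fun h : ℤ => -Complex.I * (h : ℂ)) fun h k hhk => by
        simpa [Complex.I_ne_zero] using hhk
    have htop : iSup (gradedPiece t₀ Q) = ⊤ := by
      refine submodule_eq_top_of_rootSpace_le (H := complexify t₀) ?_ fun α hα hαr => ?_
      · refine le_trans ?_ (le_iSup (gradedPiece t₀ Q) 0)
        rw [gradedPiece, if_pos rfl]
        exact le_sup_left
      · obtain ⟨h, hh⟩ := exists_mem_closure_heightGraph (hQ.mem_closure α hα hαr)
        refine le_trans ?_ (le_iSup (gradedPiece t₀ Q) h)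
        exact le_sup_of_le_right
          (le_iSup₂_of_le α (mem_qStar_iff.mpr ⟨⟨hα, hαr⟩, hh⟩) le_rfl)
    have heq := (hind.le_iff_eq_of_iSup_eq_top htop).mp hle
    refine ⟨DirectSum.isInternal_submodule_of_iSupIndep_of_iSup_eq_top (heq ▸ hind) htop, ?_⟩
    rw [heq]
    intro h k x hx y hy
    rw [Module.End.mem_eigenspace_iff] at hx hy ⊢
    rw [hAlie] at hx hy ⊢
    rw [leibniz_lie, hx, hy, smul_lie, lie_smul, ← add_smul]
    push_cast
    congr 1
    ring
  · rintro ⟨hint, -⟩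
    have hind := hint.submodule_iSupIndep
    obtain ⟨n, hadd, hn0, hneg, hn⟩ := exists_height hQ (m := 0) fun s hs => by
      by_contra hs0
      rw [zero_dvd_iff] at hs0
      by_cases hne : Q.Nonempty
      · -- A relation of height `s ≠ 0` puts the root space of `β ∈ Q` in degrees `1` and `1 + s`.
        obtain ⟨β, hβ⟩ := hne
        obtain ⟨z, hz, hz0⟩ :=
          (⟨β, (hQ.isRoot β hβ).2⟩ : Weight ℂ (complexify t₀) (ℂ ⊗[ℝ] u₀)).exists_ne_zero
        have h1 : (β, (1 : ℤ)) ∈ AddSubgroup.closure (heightGraph Q) :=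
          AddSubgroup.subset_closure ⟨β, hβ, rfl⟩
        have h2 : (β, 1 + s) ∈ AddSubgroup.closure (heightGraph Q) := by
          simpa using add_mem h1 hs
        have hmem : ∀ k, (β, k) ∈ AddSubgroup.closure (heightGraph Q) →
            z ∈ gradedPiece t₀ Q k := fun k hk =>
          (le_sup_right : _ ≤ gradedPiece t₀ Q k) (Submodule.mem_iSup_of_mem β
            (Submodule.mem_iSup_of_mem (mem_qStar_iff.mpr ⟨hQ.subset_roots hβ, hk⟩) hz))
        have hdis := hind.pairwiseDisjoint (show (1 : ℤ) ≠ 1 + s by omega)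
        exact hz0 (Submodule.disjoint_def.mp hdis z (hmem _ h1) (hmem _ h2))
      · rw [Set.not_nonempty_iff_eq_empty] at hne
        rw [hne, heightGraph, Set.image_empty, AddSubgroup.closure_empty, AddSubgroup.mem_bot] at hs
        exact hs0 (congrArg Prod.snd hs)
    obtain ⟨J, hJ⟩ := exists_derivation hconj hadd hneg
    refine ⟨J, fun x hx => ?_, (cplx_realParts_iff hconj hQ J.toLinearMap).mpr fun z hz => ?_⟩
    · have := hJ 0 (cplx x 0) (mem_rootSpace_zero.mpr (cplx_mem_complexify.mpr
        ⟨(hiso x).mp hx, zero_mem _⟩))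
      rw [hn0, Int.cast_zero, mul_zero, zero_smul, baseChange_cplx] at this
      have h0 : J x = 0 := by simpa using congrArg rePart this
      rw [h0]
      exact zero_mem _
    · refine flagSubspace_induction (p := fun z =>
        J.toLinearMap.baseChange ℂ z + Complex.I • z ∈ complexify t₀)
        (fun z hz => ?_) (fun β hβ z hz => ?_) (fun z w hz hw => ?_) hz
      · rw [hJ 0 z (mem_rootSpace_zero.mpr hz), ← add_smul]
        exact (complexify t₀).smul_mem _ hz
      · have hn1 : n β = -1 := by
          have := zero_dvd_iff.mp (hn β hβ)
          omega
        rw [hJ β z hz, hn1, ← add_smul]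
        simp
      · rw [map_add, smul_add, add_add_add_comm]
        exact add_mem hz hw

end Criteria

end CRFlag

theorem mainTheorem1 {u₀ : Type*} [LieRing u₀] [LieAlgebra ℝ u₀] [FiniteDimensional ℝ u₀]
    (hu₀ : ∀ x : u₀, x ≠ 0 → killingForm ℝ u₀ x x < 0)
    (t₀ : LieSubalgebra ℝ u₀) [IsLieAbelian t₀]
    (ht₀ : ∀ s : LieSubalgebra ℝ u₀, IsLieAbelian s → t₀ ≤ s → s = t₀)
    (Q : Set (Module.Dual ℂ (CRFlag.complexify t₀))) (hQ : CRFlag.IsFlagSet t₀ Q) :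
    (CRFlag.IsCRSymmetric (CRFlag.flagSubalgebra t₀ hQ) ↔
      ∀ h : ℤ, CRFlag.qStarOneOne t₀ Q ∩ CRFlag.qStar t₀ Q (2 * h + 1) = ∅) ∧
    (CRFlag.HasWeakJProperty (CRFlag.flagSubalgebra t₀ hQ) ↔
      ∀ h : ℤ, CRFlag.qStarOneOne t₀ Q ∩ CRFlag.qStar t₀ Q (2 * h + 1) = ∅ ∧
        CRFlag.qStarOneOne t₀ Q ∩ CRFlag.qStar t₀ Q (4 * h + 2) = ∅) ∧
    (CRFlag.HasJProperty (CRFlag.flagSubalgebra t₀ hQ) ↔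
      CRFlag.IsZGradation (CRFlag.gradedPiece t₀ Q)) := by
  have := CRFlag.isKilling_complexification hu₀
  have := CRFlag.isCartanSubalgebra_complexify hu₀ ht₀
  have hconj : ∀ α : Module.Dual ℂ (CRFlag.complexify t₀),
      ∀ z ∈ LieAlgebra.rootSpace (CRFlag.complexify t₀) α, CRFlag.conj z ∈
        LieAlgebra.rootSpace (CRFlag.complexify t₀)
          (-α : Module.Dual ℂ (CRFlag.complexify t₀)) :=
    fun _ _ hz => CRFlag.conj_mem_rootSpace hu₀ ht₀ hz
  exact ⟨CRFlag.isCRSymmetric_iff hu₀ hconj hQ, CRFlag.hasWeakJProperty_iff hconj hQ,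
    CRFlag.hasJProperty_iff hu₀ ht₀ hconj hQ⟩
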